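/- **Notation.** For $k\ge 1$ let $\tau_k=\frac1k\mathrm{Tr}$ on $\mathcal M_k(\mathbb C)$, let $\|\cdot\|$ be the operator norm, and put $\|(A_1,\dots,A_n)\|_2^2=\sum_i\tau_k(A_i^*A_i)$. Let $\omega$ be a free ultrafilter on $\mathbb N=\{1,2,\dots\}$. Let $\mathcal M_k(\mathbb C)^\omega$ be the quotient of the algebra of norm-bounded sequences $(X_k)_k$, $X_k\in\mathcal M_k(\mathbb C)$, by the ideal $\{X:\lim_{k\to\omega}\tau_k(X_k^*X_k)=0\}$, with trace $\tau_\omega([(X_k)_k])=\lim_{k\to\omega}\tau_k(X_k)$. Let $\mathcal N$ be a von Neumann algebra with a normal tracial state $\tau$, and let $\Theta$ be the set of injective unital $*$-homomorphisms $\theta:\mathcal N\to\mathcal M_k(\mathbb C)^\omega$ with $\tau_\omega\circ\theta=\tau$. Let $\Xi$ be the set of sequences $\xi=(k_m)_{m\ge1}$ of positive integers with $k_m\to\infty$. For $x_1,\dots,x_n\in\mathcal N$, $R>0$ and $\xi\in\Xi$ let $\mathfrak N_{R,\xi}(x_1,\dots,x_n)$ be the union over $\theta\in\Theta$ of the sets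 of all $((Y_{1,k})_k,\dots,(Y_{n,k})_k)\in(\prod_{k\ge1}\mathcal M_k(\mathbb C))^n$ such that $\|Y_{i,k}\|<R$ for all $i,k$ and $$\bigl|\tau_k(Y_{j_1,k}^{\epsilon_1}\cdots Y_{j_q,k}^{\epsilon_q})-\tau_\omega(\theta(x_{j_1})^{\epsilon_1}\cdots\theta(x_{j_q})^{\epsilon_q})\bigr|<\tfrac1m$$ for all $m\ge1$, $k\ge k_m$, $1\le q\le m$, $1\le j_1,\dots,j_q\le n$ and $\epsilon_1,\dots,\epsilon_q\in\{1,*\}$. Let $\mathbb P_k$ be the projection onto the $k$-th coordinate. For $\Gamma\subseteq\mathcal M_k(\mathbb C)^n$ and $\delta>0$ let $\nu(\Gamma,\delta)$ be the least number of orbit balls $\{A:\exists\,W\text{ unitary},\ \|A-WBW^*\|_2<\delta\}$ with centres $B\in\Gamma$ that cover $\Gamma$. For $s\ge0$ the $s$-embedding dimension is, in $[-\infty,\infty]$ and with $\log 0=-\infty$, $$\mathcal H_s^\omega(x_1,\dots,x_n)=\limsup_{\delta\to0^+}\ \sup_{R>0,\ \xi\in\Xi}\ \lim_{k\to\omega}\frac{\log\nu(\mathbb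 P_k(\mathfrak N_{R,\xi}(x_1,\dots,x_n)),\delta)}{k^{2s}}.$$ **Theorem 1.** Suppose that $\mathcal N$ admits a faithful trace-preserving embedding into $\mathcal M_k(\mathbb C)^\omega$, i.e. $\Theta\neq\emptyset$. If $x_1,\dots,x_n$ and $y_1,\dots,y_p$ are two finite families that each generate $\mathcal N$ as a von Neumann algebra, then $$\mathcal H_s^\omega(x_1,\dots,x_n)=\mathcal H_s^\omega(y_1,\dots,y_p)\qquad\text{for every } s\ge0.$$ So the $s$-embedding dimension is an invariant of the tracial von Neumann algebra: if $\Phi:\mathcal N\to\mathcal M$ is a $*$-isomorphism onto a von Neumann algebra $\mathcal M$ with a normal tracial state $\sigma$ and $\sigma\circ\Phi=\tau$, then $\mathcal H_s^\omega(x_1,\dots,x_n)=\mathcal H_s^\omega(y_1,\dots,y_p)$ also for every finite family $y_1,\dots,y_p$ that generates $\mathcal M$ (and $\mathcal H_s^\omega(y_1,\dots,y_p)$ is computed from $(\mathcal M,\sigma)$). -/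

import Mathlib

open Filter Topology
open scoped Matrix.Norms.L2Operator ENNReal ComplexOrder

namespace EmbDim

/-! ### Matrices, normalized trace, trace norm -/

/-- `M_k(ℂ)`, with the operator norm. -/
abbrev Mat (k : ℕ+) : Type := Matrix (Fin k) (Fin k) ℂ

instance instNonemptyFin (k : ℕ+) : Nonempty (Fin (k : ℕ)) := ⟨⟨0, k.pos⟩⟩

instance instNormOneClassMat (k : ℕ+) : NormOneClass (Mat k) := ⟨CStarRing.norm_one⟩

/-- The normalized trace `τ_k = Tr / k`. -/
noncomputable def ntr {k : ℕ+} (A : Mat k) : ℂ := A.trace / (k : ℂ)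

/-- The trace norm of a tuple: `‖(A₁, …, A_n)‖₂² = ∑ τ_k(A_i* A_i)`. -/
noncomputable def norm2 {k : ℕ+} {n : ℕ} (A : Fin n → Mat k) : ℝ :=
  Real.sqrt (∑ i, (ntr (star (A i) * A i)).re)

/-- `τ_k(A* A)` as an explicit real number (auxiliary). -/
noncomputable def sq2 {k : ℕ+} (A : Mat k) : ℝ := (∑ j, ∑ i, ‖A i j‖ ^ 2) / (k : ℝ)

theorem ntr_star_mul_self {k : ℕ+} (A : Mat k) : ntr (star A * A) = ((sq2 A : ℝ) : ℂ) := by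
  simp only [ntr, sq2, Matrix.trace, Matrix.diag, Matrix.mul_apply, Matrix.star_apply,
    RCLike.star_def]
  push_cast
  congr 1
  refine Finset.sum_congr rfl fun j _ => Finset.sum_congr rfl fun i _ => ?_
  rw [mul_comm, Complex.mul_conj, Complex.normSq_eq_norm_sq]
  push_cast
  rfl

theorem sq2_nonneg {k : ℕ+} (A : Mat k) : 0 ≤ sq2 A := by
  unfold sq2
  positivity

theorem sq2_star {k : ℕ+} (A : Mat k) : sq2 (star A) = sq2 A := by
  unfold sq2
  rw [Finset.sum_comm]
  simp [Matrix.star_apply]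

theorem sq2_add_le {k : ℕ+} (A B : Mat k) : sq2 (A + B) ≤ 2 * sq2 A + 2 * sq2 B := by
  unfold sq2
  have h : ∑ j, ∑ i, ‖(A + B) i j‖ ^ 2
      ≤ 2 * (∑ j, ∑ i, ‖A i j‖ ^ 2) + 2 * (∑ j, ∑ i, ‖B i j‖ ^ 2) := by
    simp only [Finset.mul_sum, ← Finset.sum_add_distrib]
    refine Finset.sum_le_sum fun j _ => Finset.sum_le_sum fun i _ => ?_
    have h1 : ‖(A + B) i j‖ ≤ ‖A i j‖ + ‖B i j‖ := norm_add_le _ _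
    nlinarith [sq_nonneg (‖A i j‖ - ‖B i j‖), norm_nonneg ((A + B) i j), norm_nonneg (A i j),
      norm_nonneg (B i j)]
  have hk : (0 : ℝ) < (k : ℝ) := by exact_mod_cast k.pos
  rw [mul_div_assoc', mul_div_assoc', ← add_div]
  exact div_le_div_of_nonneg_right h hk.le

theorem sq2_mul_le_left {k : ℕ+} (A B : Mat k) : sq2 (A * B) ≤ ‖A‖ ^ 2 * sq2 B := by
  unfold sq2
  have h : ∑ j, ∑ i, ‖(A * B) i j‖ ^ 2 ≤ ‖A‖ ^ 2 * ∑ j, ∑ i, ‖B i j‖ ^ 2 := by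
    rw [Finset.mul_sum]
    refine Finset.sum_le_sum fun j _ => ?_
    have h1 := Matrix.l2_opNorm_mulVec A (WithLp.toLp 2 (fun i => B i j))
    have h2 := pow_le_pow_left₀ (norm_nonneg _) h1 2
    rw [mul_pow, EuclideanSpace.norm_sq_eq, EuclideanSpace.norm_sq_eq] at h2
    simpa [Matrix.mulVec, dotProduct, Matrix.mul_apply] using h2
  have hk : (0 : ℝ) < (k : ℝ) := by exact_mod_cast k.pos
  rw [mul_div_assoc']
  exact div_le_div_of_nonneg_right h hk.le

theorem sq2_mul_le_right {k : ℕ+} (A B : Mat k) : sq2 (A * B) ≤ ‖B‖ ^ 2 * sq2 A := by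
  rw [← sq2_star (A * B), star_mul, ← sq2_star A, ← norm_star B]
  exact sq2_mul_le_left _ _

theorem sq2_one {k : ℕ+} : sq2 (1 : Mat k) = 1 := by
  have h := ntr_star_mul_self (1 : Mat k)
  have hk : (k : ℂ) ≠ 0 := by exact_mod_cast k.ne_zero
  simp only [star_one, mul_one, ntr, Matrix.trace_one, Fintype.card_fin] at h
  rw [div_self hk] at h
  exact_mod_cast h.symm

theorem sq2_le_norm_sq {k : ℕ+} (A : Mat k) : sq2 A ≤ ‖A‖ ^ 2 := by
  have h := sq2_mul_le_left A 1
  rwa [mul_one, sq2_one, mul_one] at h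

theorem norm_ntr_sq_le {k : ℕ+} (A : Mat k) : ‖ntr A‖ ^ 2 ≤ sq2 A := by
  have hk : (0 : ℝ) < (k : ℝ) := by exact_mod_cast k.pos
  have h1 : ‖∑ i, A i i‖ ^ 2 ≤ (k : ℝ) * ∑ i, ‖A i i‖ ^ 2 := by
    calc ‖∑ i, A i i‖ ^ 2 ≤ (∑ i, ‖A i i‖) ^ 2 :=
          pow_le_pow_left₀ (norm_nonneg _) (norm_sum_le _ _) 2
      _ ≤ (Finset.univ : Finset (Fin k)).card * ∑ i, ‖A i i‖ ^ 2 := sq_sum_le_card_mul_sum_sq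
      _ = (k : ℝ) * ∑ i, ‖A i i‖ ^ 2 := by simp
  have h2 : ∑ i, ‖A i i‖ ^ 2 ≤ ∑ j, ∑ i, ‖A i j‖ ^ 2 := by
    refine Finset.sum_le_sum fun j _ => ?_
    exact Finset.single_le_sum (f := fun i => ‖A i j‖ ^ 2) (fun i _ => by positivity)
      (Finset.mem_univ j)
  have h3 : ‖ntr A‖ = ‖∑ i, A i i‖ / (k : ℝ) := by
    simp [ntr, Matrix.trace, Matrix.diag]
  rw [h3, sq2, div_pow, div_le_div_iff₀ (by positivity) hk]
  nlinarith [mul_le_mul_of_nonneg_left h2 hk.le]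

theorem norm_ntr_le {k : ℕ+} (A : Mat k) : ‖ntr A‖ ≤ ‖A‖ :=
  le_of_sq_le_sq ((norm_ntr_sq_le A).trans (sq2_le_norm_sq A)) (norm_nonneg _)

theorem ntr_add {k : ℕ+} (A B : Mat k) : ntr (A + B) = ntr A + ntr B := by
  simp [ntr, add_div]

/-! ### The ultraproduct `M_k(ℂ)^ω` -/

/-- Norm-bounded sequences `(X_k)_k` with `X_k ∈ M_k(ℂ)`: the C*-algebra `ℓ^∞(ℕ, ∏ M_k(ℂ))`. -/
abbrev BddSeq : Type := lp (fun k : ℕ+ => Mat k) ∞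

theorem tendsto_ntr_star_mul_self (ω : Ultrafilter ℕ+) (X : BddSeq) :
    Tendsto (fun k => ntr (star (X k) * X k)) ω (𝓝 0) ↔
      Tendsto (fun k => sq2 (X k)) ω (𝓝 0) := by
  simp only [ntr_star_mul_self]
  constructor
  · intro h
    exact (Complex.continuous_re.tendsto 0).comp h
  · intro h
    exact (Complex.continuous_ofReal.tendsto 0).comp h

/-- The null ideal `{X | lim_{k → ω} τ_k(X_k* X_k) = 0}` of the limit trace. -/
noncomputable def nullIdeal (ω : Ultrafilter ℕ+) : Ideal BddSeq where
  carrier := {X | Tendsto (fun k => ntr (star (X k) * X k)) ω (𝓝 0)}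
  zero_mem' := by simp [ntr]
  add_mem' := by
    intro X Y hX hY
    replace hX := (tendsto_ntr_star_mul_self ω X).1 hX
    replace hY := (tendsto_ntr_star_mul_self ω Y).1 hY
    refine (tendsto_ntr_star_mul_self ω (X + Y)).2 ?_
    have h := (hX.const_mul 2).add (hY.const_mul 2)
    simp only [mul_zero, add_zero] at h
    exact squeeze_zero (fun k => sq2_nonneg _) (fun k => sq2_add_le _ _) h
  smul_mem' := by
    intro C X hX
    replace hX := (tendsto_ntr_star_mul_self ω X).1 hX
    refine (tendsto_ntr_star_mul_self ω (C • X)).2 ?_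
    have h := hX.const_mul (‖C‖ ^ 2)
    simp only [mul_zero] at h
    refine squeeze_zero (fun k => sq2_nonneg _) (fun k => ?_) h
    refine (sq2_mul_le_left (C k) (X k)).trans ?_
    exact mul_le_mul_of_nonneg_right
      (pow_le_pow_left₀ (norm_nonneg _) (lp.norm_apply_le_norm ENNReal.top_ne_zero C k) 2)
      (sq2_nonneg _)

theorem mem_nullIdeal {ω : Ultrafilter ℕ+} {X : BddSeq} :
    X ∈ nullIdeal ω ↔ Tendsto (fun k => ntr (star (X k) * X k)) ω (𝓝 0) := Iff.rfl

theorem mem_nullIdeal' {ω : Ultrafilter ℕ+} {X : BddSeq} :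
    X ∈ nullIdeal ω ↔ Tendsto (fun k => sq2 (X k)) ω (𝓝 0) :=
  tendsto_ntr_star_mul_self ω X

instance instTwoSidedNullIdeal (ω : Ultrafilter ℕ+) : (nullIdeal ω).IsTwoSided where
  mul_mem_of_left := by
    intro X C hX
    rw [mem_nullIdeal'] at hX ⊢
    have h := hX.const_mul (‖C‖ ^ 2)
    simp only [mul_zero] at h
    refine squeeze_zero (fun k => sq2_nonneg _) (fun k => ?_) h
    refine (sq2_mul_le_right (X k) (C k)).trans ?_
    exact mul_le_mul_of_nonneg_right
      (pow_le_pow_left₀ (norm_nonneg _) (lp.norm_apply_le_norm ENNReal.top_ne_zero C k) 2)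
      (sq2_nonneg _)

theorem star_mem_nullIdeal {ω : Ultrafilter ℕ+} {X : BddSeq} (hX : X ∈ nullIdeal ω) :
    star X ∈ nullIdeal ω := by
  rw [mem_nullIdeal'] at hX ⊢
  simpa [sq2_star] using hX

/-- The tracial ultraproduct `M_k(ℂ)^ω`, a unital complex *-algebra. -/
def MatUltra (ω : Ultrafilter ℕ+) : Type := BddSeq ⧸ nullIdeal ω

noncomputable instance instRingMatUltra (ω : Ultrafilter ℕ+) : Ring (MatUltra ω) :=
  Ideal.Quotient.ring (nullIdeal ω)

noncomputable instance instAlgebraMatUltra (ω : Ultrafilter ℕ+) : Algebra ℂ (MatUltra ω) :=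
  Ideal.Quotient.algebra ℂ (I := nullIdeal ω)

/-- The quotient map onto `M_k(ℂ)^ω`. -/
noncomputable def mkUltra (ω : Ultrafilter ℕ+) : BddSeq →ₐ[ℂ] MatUltra ω :=
  Ideal.Quotient.mkₐ ℂ (nullIdeal ω)

theorem mkUltra_surjective (ω : Ultrafilter ℕ+) : Function.Surjective (mkUltra ω) :=
  Ideal.Quotient.mk_surjective

theorem mkUltra_eq {ω : Ultrafilter ℕ+} {X Y : BddSeq} :
    mkUltra ω X = mkUltra ω Y ↔ X - Y ∈ nullIdeal ω := Ideal.Quotient.eq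

noncomputable instance instStarMatUltra (ω : Ultrafilter ℕ+) : Star (MatUltra ω) where
  star := Quotient.lift (fun X : BddSeq => mkUltra ω (star X)) <| by
    intro X Y h
    have h' : X - Y ∈ nullIdeal ω := (Submodule.quotientRel_def _).1 h
    refine mkUltra_eq.2 ?_
    rw [← star_sub]
    exact star_mem_nullIdeal h'

theorem star_mkUltra (ω : Ultrafilter ℕ+) (X : BddSeq) :
    star (mkUltra ω X) = mkUltra ω (star X) := rfl

noncomputable instance instStarRingMatUltra (ω : Ultrafilter ℕ+) : StarRing (MatUltra ω) where
  star_involutive z := by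
    obtain ⟨X, rfl⟩ := mkUltra_surjective ω z
    rw [star_mkUltra, star_mkUltra, star_star]
  star_mul z w := by
    obtain ⟨X, rfl⟩ := mkUltra_surjective ω z
    obtain ⟨Y, rfl⟩ := mkUltra_surjective ω w
    rw [← map_mul, star_mkUltra, star_mkUltra, star_mkUltra, ← map_mul]
    exact congrArg (mkUltra ω) (star_mul X Y)
  star_add z w := by
    obtain ⟨X, rfl⟩ := mkUltra_surjective ω z
    obtain ⟨Y, rfl⟩ := mkUltra_surjective ω w
    rw [← map_add, star_mkUltra, star_mkUltra, star_mkUltra, ← map_add, star_add]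

/-- The limit along `ω` defining the trace exists. -/
theorem exists_tendsto_ntr (ω : Ultrafilter ℕ+) (X : BddSeq) :
    ∃ c : ℂ, Tendsto (fun k => ntr (X k)) ω (𝓝 c) := by
  have hK : IsCompact (Metric.closedBall (0 : ℂ) ‖X‖) := isCompact_closedBall _ _
  obtain ⟨c, -, hc⟩ := hK.ultrafilter_le_nhds (ω.map fun k : ℕ+ => ntr (X k)) (by
    rw [Filter.le_principal_iff]
    refine Filter.mem_map.2 ?_
    refine Filter.univ_mem' fun k : ℕ+ => ?_
    refine mem_closedBall_zero_iff.2 ?_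
    exact (norm_ntr_le _).trans (lp.norm_apply_le_norm ENNReal.top_ne_zero X k))
  exact ⟨c, hc⟩

/-- The trace `τ_ω([(X_k)_k]) = lim_{k → ω} τ_k(X_k)` on `M_k(ℂ)^ω`. -/
noncomputable def ultraTrace (ω : Ultrafilter ℕ+) : MatUltra ω → ℂ :=
  Quotient.lift (fun X : BddSeq => limUnder (ω : Filter ℕ+) fun k => ntr (X k)) <| by
    intro X Y h
    have h' : X - Y ∈ nullIdeal ω := (Submodule.quotientRel_def _).1 h
    rw [mem_nullIdeal'] at h'
    obtain ⟨c, hc⟩ := exists_tendsto_ntr ω Y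
    have h0 : Tendsto (fun k => ntr ((X - Y) k)) ω (𝓝 0) := by
      rw [tendsto_zero_iff_norm_tendsto_zero]
      have h1 := h'.sqrt
      rw [Real.sqrt_zero] at h1
      exact squeeze_zero (fun k => norm_nonneg _)
        (fun k => Real.le_sqrt_of_sq_le (norm_ntr_sq_le _)) h1
    have h2 : Tendsto (fun k => ntr (X k)) ω (𝓝 c) := by
      have h3 := h0.add hc
      rw [zero_add] at h3
      refine h3.congr fun k => ?_
      rw [← ntr_add, lp.coeFn_sub, Pi.sub_apply, sub_add_cancel]
    change limUnder (ω : Filter ℕ+) (fun k => ntr (X k))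
      = limUnder (ω : Filter ℕ+) (fun k => ntr (Y k))
    rw [h2.limUnder_eq, hc.limUnder_eq]

/-- The trace of a class is a genuine limit. -/
theorem tendsto_ultraTrace (ω : Ultrafilter ℕ+) (X : BddSeq) :
    Tendsto (fun k => ntr (X k)) ω (𝓝 (ultraTrace ω (mkUltra ω X))) :=
  tendsto_nhds_limUnder (exists_tendsto_ntr ω X)

/-! ### Tracial von Neumann algebras and their embeddings -/

/-- `τ` is a normal tracial state on the von Neumann algebra `N ⊆ B(H)`; normal means
σ-weakly continuous, i.e. `τ(a) = ∑ ⟨a ξ_i, η_i⟩` with square-summable `ξ_i`, `η_i` in `H`. -/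
structure IsNormalTracialState {H : Type*} [NormedAddCommGroup H] [InnerProductSpace ℂ H]
    [CompleteSpace H] (N : VonNeumannAlgebra H) (τ : N.toStarSubalgebra →ₗ[ℂ] ℂ) : Prop where
  map_one : τ 1 = 1
  nonneg : ∀ a, 0 ≤ τ (star a * a)
  tracial : ∀ a b, τ (a * b) = τ (b * a)
  normal : ∃ ξ η : ℕ → H, Summable (fun i => ‖ξ i‖ ^ 2) ∧ Summable (fun i => ‖η i‖ ^ 2) ∧
    ∀ a : N.toStarSubalgebra,
      HasSum (fun i => inner ℂ (η i) ((a : H →L[ℂ] H) (ξ i))) (τ a)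

/-- `x₁, …, x_n` generate `N` as a von Neumann algebra: every von Neumann algebra on `H` that
contains them contains `N`. -/
def Generates {H : Type*} [NormedAddCommGroup H] [InnerProductSpace ℂ H] [CompleteSpace H]
    (N : VonNeumannAlgebra H) {n : ℕ} (x : Fin n → N.toStarSubalgebra) : Prop :=
  ∀ M : VonNeumannAlgebra H, (∀ i, (x i : H →L[ℂ] H) ∈ M) → N ≤ M

section Embeddings

variable {A : Type*} [Ring A] [StarRing A] [Algebra ℂ A]

/-- `Θ(N, M_k(ℂ)^ω)`: the faithful trace-preserving *-homomorphisms `θ : N → M_k(ℂ)^ω`. -/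
def Embeddings (ω : Ultrafilter ℕ+) (τ : A →ₗ[ℂ] ℂ) : Set (A →⋆ₐ[ℂ] MatUltra ω) :=
  {θ | Function.Injective θ ∧ ∀ a, ultraTrace ω (θ a) = τ a}

end Embeddings

/-! ### Microstate neighbourhoods -/

/-- The *-monomial `a_{j₁}^{ε₁} ⋯ a_{j_p}^{ε_p}`; the letter `(j, true)` stands for `a_j*` and
`(j, false)` for `a_j`. -/
def starWord {B : Type*} [Monoid B] [Star B] {n : ℕ} (a : Fin n → B)
    (w : List (Fin n × Bool)) : B :=
  (w.map fun l => if l.2 then star (a l.1) else a l.1).prod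

/-- `Ξ`: sequences `(k_m)_{m ≥ 1}` of positive integers tending to infinity. -/
def Xi : Set (ℕ+ → ℕ+) := {ξ | Tendsto ξ atTop atTop}

/-- The neighbourhood `𝔑_{R,ξ}(y₁, …, y_n)` of a tuple in `M_k(ℂ)^ω`. -/
def nbhdUltra (ω : Ultrafilter ℕ+) {n : ℕ} (R : ℝ) (ξ : ℕ+ → ℕ+) (y : Fin n → MatUltra ω) :
    Set (Fin n → (k : ℕ+) → Mat k) :=
  {Y | (∀ i k, ‖Y i k‖ < R) ∧
    ∀ m k : ℕ+, ξ m ≤ k → ∀ w : List (Fin n × Bool), 1 ≤ w.length → w.length ≤ (m : ℕ) →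
      ‖ntr (starWord (fun i => Y i k) w) - ultraTrace ω (starWord y w)‖ < 1 / (m : ℝ)}

section Dimension

variable {A : Type*} [Ring A] [StarRing A] [Algebra ℂ A]

/-- The neighbourhood `𝔑_{R,ξ}(x₁, …, x_n)` of a tuple in `N`: the union over all `θ ∈ Θ`. -/
def nbhd (ω : Ultrafilter ℕ+) (τ : A →ₗ[ℂ] ℂ) {n : ℕ} (R : ℝ) (ξ : ℕ+ → ℕ+) (x : Fin n → A) :
    Set (Fin n → (k : ℕ+) → Mat k) :=
  ⋃ θ ∈ Embeddings ω τ, nbhdUltra ω R ξ (fun i => θ (x i))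

/-- The projection `ℙ_k` onto the `k`-th coordinate. -/
def projAt {n : ℕ} (k : ℕ+) (Y : Fin n → (k : ℕ+) → Mat k) : Fin n → Mat k := fun i => Y i k

/-- The `δ`-orbit-ball centred at `B`. -/
def orbitBall {k : ℕ+} {n : ℕ} (B : Fin n → Mat k) (δ : ℝ) : Set (Fin n → Mat k) :=
  {C | ∃ W ∈ Matrix.unitaryGroup (Fin k) ℂ, norm2 (fun i => C i - W * B i * star W) < δ}

/-- The `δ`-orbit covering number: the least number of `δ`-orbit-balls with centres in `Γ`
that cover `Γ`. -/
noncomputable def orbitCov {k : ℕ+} {n : ℕ} (Γ : Set (Fin n → Mat k)) (δ : ℝ) : ℕ∞ :=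
  ⨅ (S : Set (Fin n → Mat k)) (_ : S ⊆ Γ) (_ : Γ ⊆ ⋃ B ∈ S, orbitBall B δ), S.encard

/-- `H_s^ω(x₁, …, x_n; R, ξ, δ) = lim_{k → ω} log ν(ℙ_k(𝔑_{R,ξ}(x)), δ) / k^{2s}`, an extended
real number, with `log 0 = -∞`. -/
noncomputable def embDimAt (ω : Ultrafilter ℕ+) (τ : A →ₗ[ℂ] ℂ) (s : ℝ) {n : ℕ} (x : Fin n → A)
    (R : ℝ) (ξ : ℕ+ → ℕ+) (δ : ℝ) : EReal :=
  limUnder (ω : Filter ℕ+) fun k : ℕ+ =>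
    ENNReal.log ((orbitCov (projAt k '' nbhd ω τ R ξ x) δ : ℕ∞) : ℝ≥0∞) /
      ((((k : ℕ) : ℝ) ^ (2 * s) : ℝ) : EReal)

/-- The limit in the definition of `embDimAt` exists in the extended reals. -/
theorem tendsto_embDimAt (ω : Ultrafilter ℕ+) (τ : A →ₗ[ℂ] ℂ) (s : ℝ) {n : ℕ} (x : Fin n → A)
    (R : ℝ) (ξ : ℕ+ → ℕ+) (δ : ℝ) :
    Tendsto (fun k : ℕ+ =>
      ENNReal.log ((orbitCov (projAt k '' nbhd ω τ R ξ x) δ : ℕ∞) : ℝ≥0∞) /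
        ((((k : ℕ) : ℝ) ^ (2 * s) : ℝ) : EReal)) ω (𝓝 (embDimAt ω τ s x R ξ δ)) := by
  refine tendsto_nhds_limUnder ?_
  obtain ⟨c, -, hc⟩ := (isCompact_univ (X := EReal)).ultrafilter_le_nhds
    (ω.map fun k : ℕ+ =>
      ENNReal.log ((orbitCov (projAt k '' nbhd ω τ R ξ x) δ : ℕ∞) : ℝ≥0∞) /
        ((((k : ℕ) : ℝ) ^ (2 * s) : ℝ) : EReal)) (by simp)
  exact ⟨c, hc⟩

/-- The `s`-embedding dimension
`H_s^ω(x₁, …, x_n) = limsup_{δ → 0⁺} sup_{R > 0, ξ ∈ Ξ} H_s^ω(x₁, …, x_n; R, ξ, δ)`. -/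
noncomputable def embDim (ω : Ultrafilter ℕ+) (τ : A →ₗ[ℂ] ℂ) (s : ℝ) {n : ℕ}
    (x : Fin n → A) : EReal :=
  limsup (fun δ : ℝ => ⨆ (R : ℝ) (_ : 0 < R) (ξ : ℕ+ → ℕ+) (_ : ξ ∈ Xi),
    embDimAt ω τ s x R ξ δ) (𝓝[>] (0 : ℝ))

end Dimension

end EmbDim

namespace EmbDim

/-! After transport along `Φ` both families lie in one algebra, and by symmetry one inequality
suffices: the dimension of `y` is at most that of `x` once the *-polynomials in `x` and those in `y`
are each dense in the 2-norm (`embDim_le_of_traceDense`). The density is the double commutant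
theorem in an amplification, tested on the vectors that represent the normal trace
(`traceDense_of_generates`).

Given `δ`, choose *-polynomials `Q` with `Q(x)` close to `y`. On bounded matrix tuples `Q` is
unitarily equivariant and Lipschitz in the 2-norm, with a constant independent of the matrix size. A
cover of the microstates of `x` by `δ'`-orbit balls is therefore pushed to a cover of the
microstates of `y`, provided that each microstate `B` of `y` is nearly `Q(D)` for a microstate `D`
of `x` (`orbitCov_le_of_approx_inverse`).

Such a `D` is `P(B)`, where the *-polynomials `P` approximate `x` by `y`
(`exists_microstate_transfer`). As more moments of `D` are prescribed, `P` must improve while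
`‖P(B)‖` stays below one fixed bound on all bounded tuples `B`. This is a Kaplansky-type argument:
real and imaginary parts are truncated by polynomials close to a cutoff function
(`exists_bounded_approximant`). Only `P` depends on the order of the moments, and that dependence is
absorbed by the sequence `ξ'`. -/

/-! ### The normalized Hilbert-Schmidt norm. -/

theorem norm2_eq_sqrt_sum_sq2 {k : ℕ+} {n : ℕ} (A : Fin n → Mat k) :
    norm2 A = Real.sqrt (∑ i, sq2 (A i)) := by
  simp [norm2, ntr_star_mul_self]

theorem norm2_eq_norm_div {k : ℕ+} {n : ℕ} (A : Fin n → Mat k) :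
    norm2 A = ‖WithLp.toLp 2 (fun p : Fin n × Fin k × Fin k => A p.1 p.2.1 p.2.2)‖ /
      Real.sqrt k := by
  rw [norm2_eq_sqrt_sum_sq2, EuclideanSpace.norm_eq, ← Real.sqrt_div (by positivity)]
  simp only [sq2, ← Finset.sum_div, Fintype.sum_prod_type]
  congr 2
  exact Finset.sum_congr rfl fun _ _ => Finset.sum_comm

theorem norm2_nonneg {k : ℕ+} {n : ℕ} (A : Fin n → Mat k) : 0 ≤ norm2 A := Real.sqrt_nonneg _

theorem norm2_add_le {k : ℕ+} {n : ℕ} (A B : Fin n → Mat k) :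
    norm2 (A + B) ≤ norm2 A + norm2 B := by
  rw [norm2_eq_norm_div, norm2_eq_norm_div, norm2_eq_norm_div, ← add_div]
  exact div_le_div_of_nonneg_right (norm_add_le
    (WithLp.toLp 2 (fun p : Fin n × Fin k × Fin k => A p.1 p.2.1 p.2.2))
    (WithLp.toLp 2 (fun p : Fin n × Fin k × Fin k => B p.1 p.2.1 p.2.2))) (Real.sqrt_nonneg _)

theorem norm2_smul {k : ℕ+} {n : ℕ} (c : ℂ) (A : Fin n → Mat k) :
    norm2 (c • A) = ‖c‖ * norm2 A := by
  rw [norm2_eq_norm_div, norm2_eq_norm_div, ← mul_div_assoc, ← norm_smul]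
  rfl

theorem norm2_neg {k : ℕ+} {n : ℕ} (A : Fin n → Mat k) : norm2 (-A) = norm2 A := by
  have := norm2_smul (-1) A
  simpa using this

theorem norm2_sub_comm {k : ℕ+} {n : ℕ} (A B : Fin n → Mat k) :
    norm2 (A - B) = norm2 (B - A) := by rw [← norm2_neg, neg_sub]

theorem norm2_sub_le {k : ℕ+} {n : ℕ} (A B C : Fin n → Mat k) :
    norm2 (A - C) ≤ norm2 (A - B) + norm2 (B - C) := by
  simpa using norm2_add_le (A - B) (B - C)

/-- The normalized Hilbert-Schmidt norm of a single matrix. -/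
noncomputable def tnorm {k : ℕ+} (A : Mat k) : ℝ := norm2 fun _ : Fin 1 => A

theorem tnorm_eq_sqrt {k : ℕ+} (A : Mat k) : tnorm A = Real.sqrt (sq2 A) := by
  simp [tnorm, norm2_eq_sqrt_sum_sq2]

theorem tnorm_nonneg {k : ℕ+} (A : Mat k) : 0 ≤ tnorm A := norm2_nonneg _

theorem tnorm_sq {k : ℕ+} (A : Mat k) : tnorm A ^ 2 = sq2 A := by
  rw [tnorm_eq_sqrt, Real.sq_sqrt (sq2_nonneg A)]

@[simp] theorem tnorm_zero {k : ℕ+} : tnorm (0 : Mat k) = 0 := by simp [tnorm_eq_sqrt, sq2]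

theorem tnorm_add_le {k : ℕ+} (A B : Mat k) : tnorm (A + B) ≤ tnorm A + tnorm B :=
  norm2_add_le _ _

theorem tnorm_smul {k : ℕ+} (c : ℂ) (A : Mat k) : tnorm (c • A) = ‖c‖ * tnorm A :=
  norm2_smul c _

theorem tnorm_sub_le {k : ℕ+} (A B C : Mat k) : tnorm (A - C) ≤ tnorm (A - B) + tnorm (B - C) :=
  norm2_sub_le _ _ _

theorem tnorm_star {k : ℕ+} (A : Mat k) : tnorm (star A) = tnorm A := by
  rw [tnorm_eq_sqrt, tnorm_eq_sqrt, sq2_star]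

theorem tnorm_mul_le_left {k : ℕ+} (A B : Mat k) : tnorm (A * B) ≤ ‖A‖ * tnorm B := by
  rw [tnorm_eq_sqrt, tnorm_eq_sqrt, ← Real.sqrt_sq (norm_nonneg A), ← Real.sqrt_mul (sq_nonneg _)]
  exact Real.sqrt_le_sqrt (sq2_mul_le_left A B)

theorem tnorm_mul_le_right {k : ℕ+} (A B : Mat k) : tnorm (A * B) ≤ tnorm A * ‖B‖ := by
  rw [← tnorm_star, star_mul, mul_comm, ← tnorm_star A, ← norm_star B]
  exact tnorm_mul_le_left _ _

theorem tnorm_le_norm {k : ℕ+} (A : Mat k) : tnorm A ≤ ‖A‖ := by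
  rw [tnorm_eq_sqrt]
  exact Real.sqrt_le_iff.2 ⟨norm_nonneg _, sq2_le_norm_sq A⟩

theorem norm_ntr_le_tnorm {k : ℕ+} (A : Mat k) : ‖ntr A‖ ≤ tnorm A := by
  rw [tnorm_eq_sqrt]
  exact Real.le_sqrt_of_sq_le (norm_ntr_sq_le A)

theorem ntr_sub {k : ℕ+} (A B : Mat k) : ntr (A - B) = ntr A - ntr B := by
  simp [ntr, sub_div]

theorem ntr_smul {k : ℕ+} (c : ℂ) (A : Mat k) : ntr (c • A) = c * ntr A := by
  simp [ntr, mul_div_assoc]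

theorem ntr_one {k : ℕ+} : ntr (1 : Mat k) = 1 := by
  simp [ntr]

theorem tnorm_le_norm2 {k : ℕ+} {n : ℕ} (A : Fin n → Mat k) (i : Fin n) :
    tnorm (A i) ≤ norm2 A := by
  rw [norm2_eq_sqrt_sum_sq2, tnorm_eq_sqrt]
  exact Real.sqrt_le_sqrt
    (Finset.single_le_sum (f := fun i => sq2 (A i)) (fun i _ => sq2_nonneg _) (Finset.mem_univ i))

theorem norm2_le_sum_tnorm {k : ℕ+} {n : ℕ} (A : Fin n → Mat k) :
    norm2 A ≤ ∑ i, tnorm (A i) := by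
  rw [norm2_eq_sqrt_sum_sq2]
  refine Real.sqrt_le_iff.2 ⟨Finset.sum_nonneg fun i _ => tnorm_nonneg _, ?_⟩
  simp only [← tnorm_sq]
  exact Finset.sum_sq_le_sq_sum_of_nonneg fun i _ => tnorm_nonneg _

theorem norm_conj_le {k : ℕ+} {W : Mat k} (hW : W ∈ Matrix.unitaryGroup (Fin k) ℂ) (A : Mat k) :
    ‖W * A * star W‖ ≤ ‖A‖ := by
  have h1 : ‖W‖ = 1 := CStarRing.norm_of_mem_unitary hW
  calc ‖W * A * star W‖ ≤ ‖W * A‖ * ‖star W‖ := norm_mul_le _ _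
    _ ≤ ‖W‖ * ‖A‖ * ‖star W‖ := by gcongr; exact norm_mul_le _ _
    _ = ‖A‖ := by rw [norm_star, h1]; ring

theorem sq2_conj_le {k : ℕ+} {W : Mat k} (hW : W ∈ Matrix.unitaryGroup (Fin k) ℂ) (A : Mat k) :
    sq2 (W * A * star W) ≤ sq2 A := by
  have h1 : ‖W‖ = 1 := CStarRing.norm_of_mem_unitary hW
  have h2 := sq2_mul_le_right (W * A) (star W)
  have h3 := sq2_mul_le_left W A
  rw [norm_star, h1, one_pow, one_mul] at h2
  rw [h1, one_pow, one_mul] at h3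
  exact h2.trans h3

theorem norm2_conj_le {k : ℕ+} {n : ℕ} {W : Mat k} (hW : W ∈ Matrix.unitaryGroup (Fin k) ℂ)
    (A : Fin n → Mat k) : norm2 (fun i => W * A i * star W) ≤ norm2 A := by
  rw [norm2_eq_sqrt_sum_sq2, norm2_eq_sqrt_sum_sq2]
  exact Real.sqrt_le_sqrt (Finset.sum_le_sum fun i _ => sq2_conj_le hW _)

/-! ### Comparison of orbit covering numbers and of dimensions. -/

/-- Orbit covering numbers decrease along maps that have an equivariant Lipschitz approximate
inverse. -/
theorem orbitCov_le_of_approx_inverse {k : ℕ+} {n p : ℕ} {Γ : Set (Fin p → Mat k)}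
    {Δ : Set (Fin n → Mat k)} (Q : (Fin n → Mat k) → Fin p → Mat k) {δ δ' ε L : ℝ}
    (happ : ∀ A ∈ Γ, ∃ X ∈ Δ, norm2 (Q X - A) < ε)
    (hlip : ∀ X ∈ Δ, ∀ B ∈ Δ, ∀ W ∈ Matrix.unitaryGroup (Fin k) ℂ,
      norm2 (Q X - fun j => W * Q B j * star W) ≤ L * norm2 (X - fun i => W * B i * star W))
    (hL : 0 ≤ L) (hδ : 2 * (ε + L * δ') ≤ δ) : orbitCov Γ δ ≤ orbitCov Δ δ' := by
  refine le_iInf fun S => le_iInf fun hS => le_iInf fun hcov => ?_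
  -- Centres must lie in `Γ`, which `Q B` need not do. Only those `B` are kept whose image has an
  -- orbit passing near `Γ`, and a nearby point of `Γ` replaces the image. This replacement costs
  -- the factor 2 in `hδ`.
  let T : Set (Fin n → Mat k) := {B | B ∈ S ∧ ∃ A ∈ Γ, ∃ W ∈ Matrix.unitaryGroup (Fin k) ℂ,
    norm2 (A - fun j => W * Q B j * star W) < ε + L * δ'}
  have hT : ∀ B : T, ∃ A ∈ Γ, ∃ W ∈ Matrix.unitaryGroup (Fin k) ℂ,
    norm2 (A - fun j => W * Q B j * star W) < ε + L * δ' := fun B => B.2.2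
  choose f hfΓ V hV hf using hT
  have hle : (Set.range f).encard ≤ S.encard := by
    rw [← Set.image_univ]
    calc (f '' Set.univ).encard ≤ (Set.univ : Set T).encard := Set.encard_image_le _ _
      _ = T.encard := Set.encard_univ T
      _ ≤ S.encard := Set.encard_le_encard fun B hB => hB.1
  refine le_trans ?_ hle
  refine iInf_le_of_le (Set.range f) (iInf_le_of_le ?_ (iInf_le _ ?_))
  · rintro _ ⟨B, rfl⟩
    exact hfΓ B
  · intro A hA
    obtain ⟨X, hX, hXA⟩ := happ A hA
    obtain ⟨B, hB, W, hW, hXB⟩ : ∃ B ∈ S, X ∈ orbitBall B δ' := by simpa using hcov hX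
    have hdist : norm2 (A - fun j => W * Q B j * star W) < ε + L * δ' := by
      have h1 := norm2_sub_le A (Q X) (fun j => W * Q B j * star W)
      rw [norm2_sub_comm A (Q X)] at h1
      have h2 := hlip X hX B (hS hB) W hW
      have h3 : L * norm2 (X - fun i => W * B i * star W) ≤ L * δ' :=
        mul_le_mul_of_nonneg_left (le_of_lt hXB) hL
      linarith
    let B' : T := ⟨B, hB, A, hA, W, hW, hdist⟩
    -- Since `f B'` is close to the conjugate of `Q B` by `V B'`, undoing `V B'` and then applying
    -- `W` brings it close to the conjugate of `Q B` by `W`.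
    refine Set.mem_iUnion₂.2 ⟨f B', ⟨B', rfl⟩, W * star (V B'), ?_, ?_⟩
    · exact mul_mem hW (Unitary.star_mem (hV B'))
    · have hVV : star (V B') * V B' = 1 := (Matrix.mem_unitaryGroup_iff').1 (hV B')
      have h1 := norm2_conj_le (mul_mem hW (Unitary.star_mem (hV B')))
        ((fun j => V B' * Q B j * star (V B')) - f B')
      have h2 : (fun i => W * star (V B') * ((fun j => V B' * Q B j * star (V B')) - f B') i *
          star (W * star (V B'))) = (fun j => W * Q B j * star W) -
          fun i => W * star (V B') * f B' i * star (W * star (V B')) := by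
        funext i
        simp only [Pi.sub_apply, mul_sub, sub_mul, star_mul, star_star]
        congr 1
        calc W * star (V B') * (V B' * Q B i * star (V B')) * (V B' * star W)
            = W * (star (V B') * V B') * Q B i * (star (V B') * V B') * star W := by
              simp only [mul_assoc]
          _ = _ := by rw [hVV]; simp
      rw [h2, norm2_sub_comm _ (f B')] at h1
      have h3 := norm2_sub_le A (fun j => W * Q B j * star W)
        (fun i => W * star (V B') * f B' i * star (W * star (V B')))
      have h4 := hf B'
      change norm2 (A - fun i => W * star (V B') * f B' i * star (W * star (V B'))) < δ
      linarith

section Comparison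

variable {A A' : Type*} [Ring A] [StarRing A] [Algebra ℂ A] [Ring A'] [StarRing A'] [Algebra ℂ A']

theorem embDimAt_le_of_eventually (ω : Ultrafilter ℕ+) (τ : A →ₗ[ℂ] ℂ) (σ : A' →ₗ[ℂ] ℂ) (s : ℝ)
    {n p : ℕ} {x : Fin n → A} {y : Fin p → A'} {R R' δ δ' : ℝ} {ξ ξ' : ℕ+ → ℕ+}
    (h : ∀ᶠ k in (ω : Filter ℕ+), orbitCov (projAt k '' nbhd ω σ R ξ y) δ ≤
      orbitCov (projAt k '' nbhd ω τ R' ξ' x) δ') :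
    embDimAt ω σ s y R ξ δ ≤ embDimAt ω τ s x R' ξ' δ' := by
  refine le_of_tendsto_of_tendsto (tendsto_embDimAt ω σ s y R ξ δ)
    (tendsto_embDimAt ω τ s x R' ξ' δ') ?_
  filter_upwards [h] with k hk
  refine EReal.div_le_div_right_of_nonneg ?_ (ENNReal.log_monotone ?_)
  · exact EReal.coe_nonneg.2 (by positivity)
  · exact_mod_cast hk

/-- The range of admissible `δ'` may depend on `δ`, `R` and `ξ`. With these fixed, the supremum at
`δ'` dominates one fixed number for all small `δ'`, hence so does its limsup. -/
theorem embDim_le_of_forall (ω : Ultrafilter ℕ+) (τ : A →ₗ[ℂ] ℂ) (σ : A' →ₗ[ℂ] ℂ) (s : ℝ)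
    {n p : ℕ} {x : Fin n → A} {y : Fin p → A'}
    (h : ∀ δ > 0, ∀ R : ℝ, 0 < R → ∀ ξ ∈ Xi, ∀ᶠ δ' in 𝓝[>] (0 : ℝ), ∃ R' : ℝ, 0 < R' ∧
      ∃ ξ' ∈ Xi, embDimAt ω σ s y R ξ δ ≤ embDimAt ω τ s x R' ξ' δ') :
    embDim ω σ s y ≤ embDim ω τ s x := by
  refine Filter.limsup_le_of_le (by isBoundedDefault) ?_
  filter_upwards [self_mem_nhdsWithin] with δ hδ
  refine iSup_le fun R => iSup_le fun hR => iSup_le fun ξ => iSup_le fun hξ => ?_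
  refine Filter.le_limsup_of_frequently_le ?_ (by isBoundedDefault)
  · refine Eventually.frequently ?_
    filter_upwards [h δ hδ R hR ξ hξ] with δ' ⟨R', hR', ξ', hξ', hle⟩
    exact le_iSup_of_le R' (le_iSup_of_le hR' (le_iSup_of_le ξ' (le_iSup_of_le hξ' hle)))

end Comparison

/-! ### *-monomials, and *-polynomials as functions on matrices of all sizes. -/

section Words

variable {B C : Type*} {n : ℕ}

theorem starWord_nil [Monoid B] [Star B] (a : Fin n → B) : starWord a [] = 1 := rfl

theorem starWord_cons [Monoid B] [Star B] (a : Fin n → B) (l : Fin n × Bool)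
    (w : List (Fin n × Bool)) :
    starWord a (l :: w) = (if l.2 then star (a l.1) else a l.1) * starWord a w := by
  simp [starWord]

theorem starWord_append [Monoid B] [Star B] (a : Fin n → B) (v w : List (Fin n × Bool)) :
    starWord a (v ++ w) = starWord a v * starWord a w := by
  simp [starWord]

theorem map_starWord [Ring B] [StarRing B] [Algebra ℂ B] [Ring C] [StarRing C] [Algebra ℂ C]
    (f : B →⋆ₐ[ℂ] C) (a : Fin n → B) (w : List (Fin n × Bool)) :
    f (starWord a w) = starWord (fun i => f (a i)) w := by
  induction w with
  | nil => simp [starWord_nil]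
  | cons l w ih => rw [starWord_cons, starWord_cons, map_mul, ih]; split_ifs <;> simp [map_star]

theorem starWord_mem [Ring B] [StarRing B] [Algebra ℂ B] [StarModule ℂ B]
    (S : StarSubalgebra ℂ B) {a : Fin n → B} (ha : ∀ i, a i ∈ S) (w : List (Fin n × Bool)) :
    starWord a w ∈ S := by
  induction w with
  | nil => exact one_mem S
  | cons l w ih =>
    rw [starWord_cons]
    refine mul_mem ?_ ih
    split_ifs
    · exact star_mem (ha _)
    · exact ha _

/-- By linearity this reduces traces of *-polynomials to *-moments. -/
theorem mem_span_starWord_of_mem_adjoin [Ring B] [StarRing B] [Algebra ℂ B] [StarModule ℂ B]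
    (a : Fin n → B) {b : B} (hb : b ∈ StarAlgebra.adjoin ℂ (Set.range a)) :
    b ∈ Submodule.span ℂ (Set.range (starWord a)) := by
  have h : b ∈ Subalgebra.toSubmodule (StarAlgebra.adjoin ℂ (Set.range a)).toSubalgebra := hb
  rw [StarAlgebra.adjoin_eq_span] at h
  refine Submodule.span_mono ?_ h
  intro c hc
  induction hc using Submonoid.closure_induction with
  | mem c hc =>
    rcases hc with ⟨i, rfl⟩ | ⟨i, hi⟩
    · exact ⟨[(i, false)], by simp [starWord]⟩
    · exact ⟨[(i, true)], by simp [starWord, hi]⟩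
  | one => exact ⟨[], rfl⟩
  | mul c d _ _ hc hd =>
    obtain ⟨v, rfl⟩ := hc
    obtain ⟨w, rfl⟩ := hd
    exact ⟨v ++ w, starWord_append a v w⟩

end Words

/-- Functions of `p`-tuples of matrices of every size. -/
abbrev MatFun (p : ℕ) : Type := (k : ℕ+) → (Fin p → Mat k) → Mat k

/-- The pair of the `j`-th coordinate function and the element `y_j`. -/
def polyGen {A : Type*} {p : ℕ} (y : Fin p → A) (j : Fin p) : MatFun p × A := (fun _ B => B j, y j)

theorem polyAlg_fst_starWord {A : Type*} [Ring A] [StarRing A] {p : ℕ} (y : Fin p → A) (w : List (Fin p × Bool)) {k : ℕ+}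
    (B : Fin p → Mat k) : (starWord (polyGen y) w).1 k B = starWord B w := by
  induction w with
  | nil => rfl
  | cons l w ih =>
    rw [starWord_cons, starWord_cons, ← ih]
    split_ifs <;> rfl

theorem polyAlg_snd_starWord {A : Type*} [Ring A] [StarRing A] {p : ℕ} (y : Fin p → A) (w : List (Fin p × Bool)) :
    (starWord (polyGen y) w).2 = starWord y w := by
  induction w with
  | nil => rfl
  | cons l w ih =>
    rw [starWord_cons, starWord_cons, ← ih]
    split_ifs <;> rfl

/-- The *-moments of `B` of length at most `m` are within `1 / m` of those of `y`. -/
def Approx {A : Type*} [Ring A] [StarRing A] [Algebra ℂ A]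
    (τ : A →ₗ[ℂ] ℂ) {p : ℕ} (y : Fin p → A) (m : ℕ+) {k : ℕ+} (B : Fin p → Mat k) : Prop :=
  ∀ w : List (Fin p × Bool), 1 ≤ w.length → w.length ≤ (m : ℕ) →
    ‖ntr (starWord B w) - τ (starWord y w)‖ < 1 / (m : ℝ)

theorem Approx.mono {A : Type*} [Ring A] [StarRing A] [Algebra ℂ A]
    {τ : A →ₗ[ℂ] ℂ} {p : ℕ} {y : Fin p → A} {m M : ℕ+} (hmM : m ≤ M) {k : ℕ+}
    {B : Fin p → Mat k} (h : Approx τ y M B) : Approx τ y m B := by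
  intro w h1 h2
  have hm : (0 : ℝ) < (m : ℕ) := by exact_mod_cast m.pos
  have hmM' : ((m : ℕ) : ℝ) ≤ (M : ℕ) := by exact_mod_cast hmM
  exact (h w h1 (h2.trans hmM)).trans_le (one_div_le_one_div_of_le hm hmM')

section Polynomials

variable {A : Type*} [Ring A] [StarRing A] [Algebra ℂ A] [StarModule ℂ A]

/-- The *-polynomials in `p` variables, remembered through their values on all tuples of matrices
and on the tuple `y`. -/
noncomputable def polyAlg {p : ℕ} (y : Fin p → A) : StarSubalgebra ℂ (MatFun p × A) :=
  StarAlgebra.adjoin ℂ (Set.range (polyGen y))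

theorem polyGen_mem {p : ℕ} (y : Fin p → A) (j : Fin p) : polyGen y j ∈ polyAlg y :=
  StarAlgebra.subset_adjoin ℂ _ ⟨j, rfl⟩

@[elab_as_elim]
theorem polyAlg_induction {p : ℕ} {y : Fin p → A}
    {motive : (P : MatFun p × A) → P ∈ polyAlg y → Prop}
    (gen : ∀ j, motive (polyGen y j) (polyGen_mem y j))
    (scalar : ∀ r : ℂ, motive (algebraMap ℂ _ r) ((polyAlg y).algebraMap_mem r))
    (add : ∀ P Q hP hQ, motive P hP → motive Q hQ → motive (P + Q) (add_mem hP hQ))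
    (mul : ∀ P Q hP hQ, motive P hP → motive Q hQ → motive (P * Q) (mul_mem hP hQ))
    (star : ∀ P hP, motive P hP → motive (star P) (star_mem hP)) {P : MatFun p × A}
    (hP : P ∈ polyAlg y) : motive P hP := by
  refine StarAlgebra.adjoin_induction (fun P h => ?_) scalar add mul star hP
  obtain ⟨j, rfl⟩ := h
  exact gen j

theorem exists_mem_polyAlg_snd {p : ℕ} {y : Fin p → A} {b : A}
    (hb : b ∈ StarAlgebra.adjoin ℂ (Set.range y)) : ∃ P ∈ polyAlg y, P.2 = b := by
  induction hb using StarAlgebra.adjoin_induction with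
  | mem b h => obtain ⟨j, rfl⟩ := h; exact ⟨_, polyGen_mem y j, rfl⟩
  | algebraMap r => exact ⟨algebraMap ℂ _ r, (polyAlg y).algebraMap_mem r, rfl⟩
  | add b c _ _ h1 h2 =>
    obtain ⟨P, hP, rfl⟩ := h1
    obtain ⟨Q, hQ, rfl⟩ := h2
    exact ⟨P + Q, add_mem hP hQ, rfl⟩
  | mul b c _ _ h1 h2 =>
    obtain ⟨P, hP, rfl⟩ := h1
    obtain ⟨Q, hQ, rfl⟩ := h2
    exact ⟨P * Q, mul_mem hP hQ, rfl⟩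
  | star b _ h =>
    obtain ⟨P, hP, rfl⟩ := h
    exact ⟨star P, star_mem hP, rfl⟩

theorem exists_norm_bound {p : ℕ} {y : Fin p → A} {P : MatFun p × A} (hP : P ∈ polyAlg y)
    (R : ℝ) : ∃ C : ℝ, 0 ≤ C ∧ ∀ k (B : Fin p → Mat k), (∀ j, ‖B j‖ ≤ R) → ‖P.1 k B‖ ≤ C := by
  induction hP using polyAlg_induction with
  | gen j => exact ⟨|R|, abs_nonneg _, fun k B hB => (hB j).trans (le_abs_self R)⟩
  | scalar r =>
    refine ⟨‖r‖, norm_nonneg _, fun k B _ => ?_⟩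
    change ‖algebraMap ℂ (Mat k) r‖ ≤ ‖r‖
    rw [norm_algebraMap']
  | add P Q _ _ h1 h2 =>
    obtain ⟨C, hC, h1⟩ := h1
    obtain ⟨D, hD, h2⟩ := h2
    exact ⟨C + D, by positivity, fun k B hB =>
      (norm_add_le _ _).trans (add_le_add (h1 k B hB) (h2 k B hB))⟩
  | mul P Q _ _ h1 h2 =>
    obtain ⟨C, hC, h1⟩ := h1
    obtain ⟨D, hD, h2⟩ := h2
    exact ⟨C * D, by positivity, fun k B hB =>
      (norm_mul_le _ _).trans (mul_le_mul (h1 k B hB) (h2 k B hB) (norm_nonneg _) hC)⟩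
  | star P _ h =>
    obtain ⟨C, hC, h⟩ := h
    exact ⟨C, hC, fun k B hB => (norm_star (P.1 k B)).trans_le (h k B hB)⟩

/-- What matters is that `L` does not depend on `k`. For products, each difference is measured in
the 2-norm while the other factor is bounded in operator norm. -/
theorem exists_lipschitz {p : ℕ} {y : Fin p → A} {P : MatFun p × A} (hP : P ∈ polyAlg y)
    (R : ℝ) : ∃ L : ℝ, 0 ≤ L ∧ ∀ k (B B' : Fin p → Mat k), (∀ j, ‖B j‖ ≤ R) →
      (∀ j, ‖B' j‖ ≤ R) → tnorm (P.1 k B - P.1 k B') ≤ L * norm2 (B - B') := by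
  induction hP using polyAlg_induction with
  | gen j =>
    refine ⟨1, zero_le_one, fun k B B' _ _ => ?_⟩
    rw [one_mul]
    exact tnorm_le_norm2 (B - B') j
  | scalar r =>
    refine ⟨0, le_rfl, fun k B B' _ _ => ?_⟩
    change tnorm (algebraMap ℂ (Mat k) r - algebraMap ℂ (Mat k) r) ≤ _
    simp
  | add P Q _ _ h1 h2 =>
    obtain ⟨C, hC, h1⟩ := h1
    obtain ⟨D, hD, h2⟩ := h2
    refine ⟨C + D, by positivity, fun k B B' hB hB' => ?_⟩
    have h3 := tnorm_add_le (P.1 k B - P.1 k B') (Q.1 k B - Q.1 k B')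
    have h4 := h1 k B B' hB hB'
    have h5 := h2 k B B' hB hB'
    change tnorm (P.1 k B + Q.1 k B - (P.1 k B' + Q.1 k B')) ≤ _
    rw [add_sub_add_comm, add_mul]
    linarith
  | mul P Q hP hQ h1 h2 =>
    obtain ⟨C, hC, h1⟩ := h1
    obtain ⟨D, hD, h2⟩ := h2
    obtain ⟨E, hE, h3⟩ := exists_norm_bound hP R
    obtain ⟨F, hF, h4⟩ := exists_norm_bound hQ R
    refine ⟨C * F + E * D, by positivity, fun k B B' hB hB' => ?_⟩
    change tnorm (P.1 k B * Q.1 k B - P.1 k B' * Q.1 k B') ≤ _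
    have h5 : P.1 k B * Q.1 k B - P.1 k B' * Q.1 k B' =
        (P.1 k B - P.1 k B') * Q.1 k B + P.1 k B' * (Q.1 k B - Q.1 k B') := by noncomm_ring
    rw [h5]
    refine (tnorm_add_le _ _).trans ?_
    have hn := norm2_nonneg (B - B')
    have h6 := (tnorm_mul_le_right (P.1 k B - P.1 k B') (Q.1 k B)).trans
      (mul_le_mul (h1 k B B' hB hB') (h4 k B hB) (norm_nonneg _) (by positivity))
    have h7 := (tnorm_mul_le_left (P.1 k B') (Q.1 k B - Q.1 k B')).trans
      (mul_le_mul (h3 k B' hB') (h2 k B B' hB hB') (tnorm_nonneg _) hE)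
    linarith
  | star P _ h =>
    obtain ⟨C, hC, h⟩ := h
    refine ⟨C, hC, fun k B B' hB hB' => ?_⟩
    change tnorm (star (P.1 k B) - star (P.1 k B')) ≤ _
    rw [← star_sub, tnorm_star]
    exact h k B B' hB hB'

theorem polyAlg_conj {p : ℕ} {y : Fin p → A} {P : MatFun p × A} (hP : P ∈ polyAlg y)
    {k : ℕ+} {W : Mat k} (hW : W ∈ Matrix.unitaryGroup (Fin k) ℂ) (B : Fin p → Mat k) :
    P.1 k (fun j => W * B j * star W) = W * P.1 k B * star W := by
  have h1 : W * star W = 1 := Matrix.mem_unitaryGroup_iff.1 hW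
  have h2 : star W * W = 1 := Matrix.mem_unitaryGroup_iff'.1 hW
  induction hP using polyAlg_induction with
  | gen j => rfl
  | scalar r =>
    change algebraMap ℂ (Mat k) r = W * algebraMap ℂ (Mat k) r * star W
    rw [← Algebra.commutes, mul_assoc, h1, mul_one]
  | add P Q _ _ hP hQ =>
    change P.1 k _ + Q.1 k _ = W * (P.1 k B + Q.1 k B) * star W
    rw [hP, hQ, mul_add, add_mul]
  | mul P Q _ _ hP hQ =>
    change P.1 k _ * Q.1 k _ = W * (P.1 k B * Q.1 k B) * star W
    rw [hP, hQ]
    calc W * P.1 k B * star W * (W * Q.1 k B * star W)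
        = W * P.1 k B * (star W * W) * Q.1 k B * star W := by simp only [mul_assoc]
      _ = _ := by rw [h2]; simp only [mul_assoc, mul_one]
  | star P _ hP =>
    change star (P.1 k _) = W * star (P.1 k B) * star W
    rw [hP]
    simp only [star_mul, star_star, mul_assoc]

/-- Substitution of polynomials. The component `P.2` is left unspecified: its trace is recovered
later as a limit of traces of matrix values. -/
theorem exists_comp_mem_polyAlg {A' : Type*} [Ring A'] [StarRing A'] [Algebra ℂ A']
    [StarModule ℂ A'] {n p : ℕ} {x : Fin n → A'} {y : Fin p → A} {F : Fin n → MatFun p × A}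
    (hF : ∀ i, F i ∈ polyAlg y) {V : MatFun n × A'} (hV : V ∈ polyAlg x) :
    ∃ P ∈ polyAlg y, ∀ k B, P.1 k B = V.1 k (fun i => (F i).1 k B) := by
  induction hV using polyAlg_induction with
  | gen j => exact ⟨F j, hF j, fun _ _ => rfl⟩
  | scalar r => exact ⟨algebraMap ℂ _ r, (polyAlg y).algebraMap_mem r, fun _ _ => rfl⟩
  | add P Q _ _ h1 h2 =>
    obtain ⟨P', hP, h1⟩ := h1
    obtain ⟨Q', hQ, h2⟩ := h2
    exact ⟨P' + Q', add_mem hP hQ, fun k B => congrArg₂ (· + ·) (h1 k B) (h2 k B)⟩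
  | mul P Q _ _ h1 h2 =>
    obtain ⟨P', hP, h1⟩ := h1
    obtain ⟨Q', hQ, h2⟩ := h2
    exact ⟨P' * Q', mul_mem hP hQ, fun k B => congrArg₂ (· * ·) (h1 k B) (h2 k B)⟩
  | star P _ h =>
    obtain ⟨P', hP, h⟩ := h
    exact ⟨star P', star_mem hP, fun k B => congrArg star (h k B)⟩

/-- This links the two components of an element of `polyAlg`: along lifts of the generators, the
matrix values form a lift of the image of the algebra element. It turns relations in the algebra
into asymptotic ones between matrices. -/
theorem exists_lift_polyAlg {ω : Ultrafilter ℕ+} (θ : A →⋆ₐ[ℂ] MatUltra ω) {p : ℕ}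
    {y : Fin p → A} {Y : Fin p → BddSeq} (hY : ∀ j, mkUltra ω (Y j) = θ (y j))
    {P : MatFun p × A} (hP : P ∈ polyAlg y) :
    ∃ Z : BddSeq, (∀ k, Z k = P.1 k (fun j => Y j k)) ∧ mkUltra ω Z = θ P.2 := by
  induction hP using polyAlg_induction with
  | gen j => exact ⟨Y j, fun _ => rfl, hY j⟩
  | scalar r =>
    refine ⟨algebraMap ℂ _ r, fun k => rfl, ?_⟩
    rw [AlgHomClass.commutes]
    exact (AlgHomClass.commutes θ r).symm
  | add P Q _ _ h1 h2 =>
    obtain ⟨Z, hZ, h1⟩ := h1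
    obtain ⟨T, hT, h2⟩ := h2
    refine ⟨Z + T, fun k => congrArg₂ (· + ·) (hZ k) (hT k), ?_⟩
    rw [map_add, h1, h2, Prod.snd_add, map_add]
  | mul P Q _ _ h1 h2 =>
    obtain ⟨Z, hZ, h1⟩ := h1
    obtain ⟨T, hT, h2⟩ := h2
    refine ⟨Z * T, fun k => congrArg₂ (· * ·) (hZ k) (hT k), ?_⟩
    rw [map_mul, h1, h2, Prod.snd_mul, map_mul]
  | star P _ h =>
    obtain ⟨Z, hZ, h⟩ := h
    refine ⟨star Z, fun k => congrArg star (hZ k), ?_⟩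
    rw [← star_mkUltra, h, Prod.snd_star, map_star]

/-- The trace of a *-polynomial is controlled by finitely many *-moments. -/
theorem eventually_ntr_close {τ : A →ₗ[ℂ] ℂ} (hτ : τ 1 = 1) {p : ℕ} {y : Fin p → A}
    {P : MatFun p × A} (hP : P ∈ polyAlg y) {ε : ℝ} (hε : 0 < ε) :
    ∀ᶠ M : ℕ+ in atTop, ∀ k (B : Fin p → Mat k), Approx τ y M B →
      ‖ntr (P.1 k B) - τ P.2‖ < ε := by
  have hspan := mem_span_starWord_of_mem_adjoin _ hP
  clear hP
  induction hspan using Submodule.span_induction generalizing ε with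
  | mem P h =>
    obtain ⟨w, rfl⟩ := h
    simp only [polyAlg_fst_starWord, polyAlg_snd_starWord]
    rcases Nat.eq_zero_or_pos w.length with h0 | hpos
    -- `Approx` does not test the empty word; here `τ 1 = 1` is needed.
    · rw [List.length_eq_zero_iff.1 h0]
      exact Eventually.of_forall fun M k B _ => by simpa [starWord_nil, ntr_one, hτ] using hε
    · obtain ⟨N, hN⟩ := exists_nat_one_div_lt hε
      filter_upwards [eventually_ge_atTop (⟨max w.length (N + 1), by positivity⟩ : ℕ+)] with M hM
      have hM' : max w.length (N + 1) ≤ (M : ℕ) := hM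
      intro k B hB
      refine (hB w hpos ((le_max_left _ _).trans hM')).trans_le (le_trans ?_ hN.le)
      refine one_div_le_one_div_of_le (by positivity) ?_
      exact_mod_cast (le_max_right _ _).trans hM'
  | zero =>
    refine Eventually.of_forall fun M k B _ => ?_
    change ‖ntr (0 : Mat k) - τ 0‖ < ε
    simpa [ntr] using hε
  | add P Q _ _ h1 h2 =>
    filter_upwards [h1 (half_pos hε), h2 (half_pos hε)] with M h1 h2 k B hB
    have h3 := h1 k B hB
    have h4 := h2 k B hB
    change ‖ntr (P.1 k B + Q.1 k B) - τ (P.2 + Q.2)‖ < ε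
    rw [ntr_add, map_add, add_sub_add_comm]
    linarith [norm_add_le (ntr (P.1 k B) - τ P.2) (ntr (Q.1 k B) - τ Q.2)]
  | smul c P _ h =>
    have hc : 0 < ‖c‖ + 1 := by positivity
    filter_upwards [h (div_pos hε hc)] with M h k B hB
    have h3 := h k B hB
    change ‖ntr (c • P.1 k B) - τ (c • P.2)‖ < ε
    rw [ntr_smul, map_smul, smul_eq_mul, ← mul_sub, norm_mul]
    rw [lt_div_iff₀ hc] at h3
    nlinarith [norm_nonneg (ntr (P.1 k B) - τ P.2)]

end Polynomials

/-! ### Spectral truncation of Hermitian matrices. -/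

theorem norm_entry_le {k : ℕ+} (A : Mat k) (i j : Fin k) : ‖A i j‖ ≤ ‖A‖ := by
  have h1 := Matrix.l2_opNorm_mulVec A (EuclideanSpace.single j (1 : ℂ))
  rw [PiLp.norm_single, norm_one, mul_one] at h1
  refine le_trans ?_ h1
  have h2 := PiLp.norm_apply_le (p := 2) ((EuclideanSpace.equiv (Fin k) ℂ).symm <| A.mulVec
    (EuclideanSpace.single j (1 : ℂ)).ofLp) i
  simpa using h2

theorem abs_clamp_sub_le {c t r : ℝ} (hr : |r| ≤ c) : |max (-c) (min c t) - r| ≤ |t - r| := by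
  rw [abs_le] at hr
  rcases le_total c t with h | h
  · rw [min_eq_left h, max_eq_right (by linarith), abs_of_nonneg (by linarith),
      abs_of_nonneg (by linarith)]
    linarith
  · rw [min_eq_right h]
    rcases le_total (-c) t with h' | h'
    · rw [max_eq_right h']
    · rw [max_eq_left h', abs_of_nonpos (by linarith), abs_of_nonpos (by linarith)]
      linarith

/-- The Hilbert-Schmidt norm is computed entrywise, so no commutation with `a` is needed. The
off-diagonal entries do not change, and the diagonal entries of `a` are real and lie in `[-c, c]`,
so clamping moves `d i` no farther from them. -/
theorem tnorm_diagonal_clamp_sub_le {k : ℕ+} {c : ℝ} (d : Fin k → ℝ) {a : Mat k}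
    (ha : star a = a) (hac : ‖a‖ ≤ c) :
    tnorm (Matrix.diagonal (fun i => ((max (-c) (min c (d i)) : ℝ) : ℂ)) - a) ≤
      tnorm (Matrix.diagonal (fun i => (d i : ℂ)) - a) := by
  rw [tnorm_eq_sqrt, tnorm_eq_sqrt]
  refine Real.sqrt_le_sqrt (div_le_div_of_nonneg_right
    (Finset.sum_le_sum fun j _ => Finset.sum_le_sum fun i _ => ?_) (by positivity))
  refine pow_le_pow_left₀ (norm_nonneg _) ?_ 2
  rcases eq_or_ne i j with rfl | hij
  · have hreal : ((a i i).re : ℂ) = a i i := by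
      refine Complex.conj_eq_iff_re.1 ?_
      have := congrFun (congrFun ha i) i
      simpa [Matrix.star_apply] using this
    have hle : |(a i i).re| ≤ c := ((Complex.abs_re_le_norm _).trans (norm_entry_le a i i)).trans hac
    rw [Matrix.sub_apply, Matrix.sub_apply, Matrix.diagonal_apply_eq, Matrix.diagonal_apply_eq,
      ← hreal, ← Complex.ofReal_sub, ← Complex.ofReal_sub, Complex.norm_real, Complex.norm_real]
    exact abs_clamp_sub_le hle
  · simp [Matrix.diagonal_apply_ne _ hij]

/-- A Hermitian matrix is simultaneously diagonalized with its real polynomials. -/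
theorem exists_unitary_diagonalization {k : ℕ+} {b : Mat k} (hb : b.IsHermitian) {C : ℝ}
    (hbC : ‖b‖ ≤ C) : ∃ (U : Mat k) (d : Fin k → ℝ), U ∈ Matrix.unitaryGroup (Fin k) ℂ ∧
      (∀ i, d i ∈ Set.Icc (-C) C) ∧
      b = U * Matrix.diagonal (fun i => (d i : ℂ)) * star U ∧
      ∀ g : Polynomial ℝ, Polynomial.aeval b (g.map (algebraMap ℝ ℂ)) =
        U * Matrix.diagonal (fun i => ((g.eval (d i) : ℝ) : ℂ)) * star U := by
  have hU : (hb.eigenvectorUnitary : Mat k) ∈ Matrix.unitaryGroup (Fin k) ℂ :=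
    hb.eigenvectorUnitary.2
  have hspec : b = Unitary.conjStarAlgAut ℂ (Mat k) hb.eigenvectorUnitary
    (Matrix.diagonal (fun i => (hb.eigenvalues i : ℂ))) := hb.spectral_theorem
  refine ⟨hb.eigenvectorUnitary, hb.eigenvalues, hU, fun i => ?_, ?_, fun g => ?_⟩
  · have h1 := norm_conj_le (Unitary.star_mem hU) b
    have h2 : star (hb.eigenvectorUnitary : Mat k) * b * star (star (hb.eigenvectorUnitary : Mat k))
        = Matrix.diagonal (fun i => (hb.eigenvalues i : ℂ)) := by
      have h3 := congrArg (Unitary.conjStarAlgAut ℂ (Mat k) hb.eigenvectorUnitary).symm hspec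
      rw [StarAlgEquiv.symm_apply_apply, Unitary.conjStarAlgAut_symm_apply] at h3
      simpa using h3
    rw [h2] at h1
    rw [Set.mem_Icc, ← abs_le, ← Real.norm_eq_abs, ← Complex.norm_real]
    simpa using (norm_entry_le _ i i).trans (h1.trans hbC)
  · rw [← Unitary.conjStarAlgAut_apply (R := Mat k) (S := ℂ)]
    exact hspec
  · have h1 : Polynomial.aeval (Matrix.diagonal (fun i => (hb.eigenvalues i : ℂ)))
        (g.map (algebraMap ℝ ℂ)) =
        Matrix.diagonal fun i => ((g.eval (hb.eigenvalues i) : ℝ) : ℂ) := by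
      rw [← Matrix.diagonalAlgHom_apply (R := ℂ), Polynomial.aeval_algHom_apply,
        Matrix.diagonalAlgHom_apply]
      congr 1
      funext i
      rw [Polynomial.aeval_pi_apply]
      beta_reduce
      rw [Polynomial.aeval_map_algebraMap]
      exact Polynomial.aeval_algebraMap_apply ℂ (hb.eigenvalues i) g
    rw [← Unitary.conjStarAlgAut_apply (R := Mat k) (S := ℂ), ← h1]
    conv_lhs => rw [hspec]
    exact Polynomial.aeval_algHom_apply
      ((Unitary.conjStarAlgAut ℂ (Mat k) hb.eigenvectorUnitary : Mat k ≃⋆ₐ[ℂ] Mat k) :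
        Mat k →ₐ[ℂ] Mat k) _ _

/-- A polynomial close to the cutoff at height `c`, applied to a Hermitian matrix, does not
increase the distance to a Hermitian matrix of norm at most `c`. -/
theorem tnorm_aeval_clamp_sub_le {k : ℕ+} {a b : Mat k} (hb : b.IsHermitian) (ha : star a = a)
    {c C ε : ℝ} (hac : ‖a‖ ≤ c) (hbC : ‖b‖ ≤ C) {g : Polynomial ℝ}
    (hg : ∀ t ∈ Set.Icc (-C) C, |g.eval t - max (-c) (min c t)| ≤ ε) :
    tnorm (Polynomial.aeval b (g.map (algebraMap ℝ ℂ)) - a) ≤ ε + tnorm (b - a) := by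
  obtain ⟨U, d, hU, hd, hbd, hgd⟩ := exists_unitary_diagonalization hb hbC
  have hUU : U * star U = 1 := Matrix.mem_unitaryGroup_iff.1 hU
  have hUU' : star U * U = 1 := Matrix.mem_unitaryGroup_iff'.1 hU
  -- Pass to the eigenbasis of `b`; there `b` is diagonal and `a'` is still Hermitian of norm at
  -- most `c`.
  set a' : Mat k := star U * a * U with ha'_def
  have ha_eq : a = U * a' * star U := by
    calc a = (U * star U) * a * (U * star U) := by rw [hUU]; simp
      _ = _ := by simp only [ha'_def, mul_assoc]
  have ha' : star a' = a' := by simp [ha'_def, ha, mul_assoc]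
  have hac' : ‖a'‖ ≤ c := by
    have := norm_conj_le (Unitary.star_mem hU) a
    rw [star_star] at this
    exact this.trans hac
  have h1 : tnorm (Matrix.diagonal (fun i => ((g.eval (d i) : ℝ) : ℂ)) -
      Matrix.diagonal (fun i => ((max (-c) (min c (d i)) : ℝ) : ℂ))) ≤ ε := by
    refine (tnorm_le_norm _).trans ?_
    rw [Matrix.diagonal_sub, Matrix.l2_opNorm_diagonal, pi_norm_le_iff_of_nonempty]
    intro i
    rw [← Complex.ofReal_sub, Complex.norm_real]
    exact hg _ (hd i)
  have h2 := tnorm_diagonal_clamp_sub_le d ha' hac'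
  have h3 : tnorm (Matrix.diagonal (fun i => (d i : ℂ)) - a') ≤ tnorm (b - a) := by
    have h5 : Matrix.diagonal (fun i => (d i : ℂ)) - a' = star U * (b - a) * star (star U) := by
      rw [star_star, hbd, mul_sub, sub_mul]
      congr 1
      calc Matrix.diagonal (fun i => (d i : ℂ))
          = (star U * U) * Matrix.diagonal (fun i => (d i : ℂ)) * (star U * U) := by
            rw [hUU']; simp
        _ = _ := by simp only [mul_assoc]
    rw [h5]
    exact norm2_conj_le (Unitary.star_mem hU) fun _ : Fin 1 => b - a
  have h4 : Polynomial.aeval b (g.map (algebraMap ℝ ℂ)) - a =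
      U * (Matrix.diagonal (fun i => ((g.eval (d i) : ℝ) : ℂ)) - a') * star U := by
    rw [mul_sub, sub_mul, ← hgd, ← ha_eq]
  rw [h4]
  exact (norm2_conj_le hU fun _ : Fin 1 => _).trans
    ((tnorm_sub_le _ _ _).trans (add_le_add h1 (h2.trans h3)))

theorem norm_aeval_clamp_le {k : ℕ+} {b : Mat k} (hb : b.IsHermitian)
    {c C ε : ℝ} (hc : 0 ≤ c) (hbC : ‖b‖ ≤ C) {g : Polynomial ℝ}
    (hg : ∀ t ∈ Set.Icc (-C) C, |g.eval t - max (-c) (min c t)| ≤ ε) :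
    ‖Polynomial.aeval b (g.map (algebraMap ℝ ℂ))‖ ≤ c + ε := by
  obtain ⟨U, d, hU, hd, -, hgd⟩ := exists_unitary_diagonalization hb hbC
  rw [hgd]
  refine (norm_conj_le hU _).trans ?_
  rw [Matrix.l2_opNorm_diagonal, pi_norm_le_iff_of_nonempty]
  intro i
  rw [Complex.norm_real, Real.norm_eq_abs]
  have h1 := hg _ (hd i)
  have h2 : |max (-c) (min c (d i))| ≤ c :=
    abs_le.2 ⟨le_max_left _ _, max_le (by linarith) (min_le_left _ _)⟩
  have h3 := abs_add_le (g.eval (d i) - max (-c) (min c (d i))) (max (-c) (min c (d i)))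
  rw [sub_add_cancel] at h3
  linarith

/-! ### *-polynomial approximants with uniform operator norm bounds. -/

section Approximants

variable {A : Type*} [Ring A] [StarRing A] [Algebra ℂ A] {ω : Ultrafilter ℕ+}

theorem tendsto_ntr_of_lift {τ : A →ₗ[ℂ] ℂ} {θ : A →⋆ₐ[ℂ] MatUltra ω}
    (hθ : ∀ a, ultraTrace ω (θ a) = τ a) {Z : BddSeq} {z : A} (hZ : mkUltra ω Z = θ z) :
    Tendsto (fun k => ntr (Z k)) ω (𝓝 (τ z)) := by
  rw [← hθ, ← hZ]
  exact tendsto_ultraTrace ω Z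

theorem tendsto_sq2_of_lift {τ : A →ₗ[ℂ] ℂ} {θ : A →⋆ₐ[ℂ] MatUltra ω}
    (hθ : ∀ a, ultraTrace ω (θ a) = τ a) {Z : BddSeq} {z : A} (hZ : mkUltra ω Z = θ z) :
    Tendsto (fun k => sq2 (Z k)) ω (𝓝 (τ (star z * z)).re) := by
  have h : mkUltra ω (star Z * Z) = θ (star z * z) := by
    rw [map_mul, ← star_mkUltra, hZ, map_mul, map_star]
  refine ((Complex.continuous_re.tendsto _).comp (tendsto_ntr_of_lift hθ h)).congr fun k => ?_
  change (ntr (star (Z k) * Z k)).re = _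
  rw [ntr_star_mul_self, Complex.ofReal_re]

theorem eventually_tnorm_lt_of_lift {τ : A →ₗ[ℂ] ℂ} {θ : A →⋆ₐ[ℂ] MatUltra ω}
    (hθ : ∀ a, ultraTrace ω (θ a) = τ a) {Z : BddSeq} {z : A} (hZ : mkUltra ω Z = θ z) {η : ℝ}
    (hη : 0 < η) (hz : (τ (star z * z)).re < η ^ 2) :
    ∀ᶠ k in (ω : Filter ℕ+), tnorm (Z k) < η := by
  filter_upwards [(tendsto_sq2_of_lift hθ hZ).eventually_lt_const hz] with k hk
  rw [← tnorm_sq] at hk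
  exact lt_of_pow_lt_pow_left₀ 2 hη.le hk

variable [StarModule ℂ A]

/-- The *-algebra generated by `y` is dense in the 2-norm of `τ`. -/
def TraceDense (τ : A →ₗ[ℂ] ℂ) {p : ℕ} (y : Fin p → A) : Prop :=
  ∀ a : A, ∀ η : ℝ, 0 < η → ∃ b ∈ StarAlgebra.adjoin ℂ (Set.range y),
    (τ (star (b - a) * (b - a))).re < η

theorem polyAlg_aeval_mem {p : ℕ} {y : Fin p → A} {P : MatFun p × A} (hP : P ∈ polyAlg y)
    (g : Polynomial ℂ) : ∃ Q ∈ polyAlg y, ∀ k B, Q.1 k B = Polynomial.aeval (P.1 k B) g := by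
  induction g using Polynomial.induction_on' with
  | add g h hg hh =>
    obtain ⟨Q, hQ, hg⟩ := hg
    obtain ⟨Q', hQ', hh⟩ := hh
    refine ⟨Q + Q', add_mem hQ hQ', fun k B => ?_⟩
    rw [map_add, ← hg, ← hh]
    rfl
  | monomial m r =>
    refine ⟨r • P ^ m, (polyAlg y).smul_mem (pow_mem hP m) r, fun k B => ?_⟩
    rw [Polynomial.aeval_monomial, ← Algebra.smul_def]
    rfl

/-- Hermitian elements are approximated by *-polynomials that are uniformly bounded on matrices. -/
theorem exists_bounded_approximant_of_hermitian {p : ℕ} {y : Fin p → A} {Y X : (k : ℕ+) → _}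
    {P : MatFun p × A} (hP : P ∈ polyAlg y) (hherm : ∀ k B, star (P.1 k B) = P.1 k B)
    {R c ε : ℝ} (hc : 0 ≤ c) (hε : 0 < ε) (hY : ∀ k j, ‖(Y k : Fin p → Mat k) j‖ ≤ R)
    (hX : ∀ k, star (X k : Mat k) = X k) (hXc : ∀ k, ‖X k‖ ≤ c) :
    ∃ Q ∈ polyAlg y, (∀ k (B : Fin p → Mat k), (∀ j, ‖B j‖ ≤ R) → ‖Q.1 k B‖ ≤ c + ε) ∧
      ∀ k, tnorm (Q.1 k (Y k) - X k) ≤ ε + tnorm (P.1 k (Y k) - X k) := by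
  obtain ⟨C, -, hC⟩ := exists_norm_bound hP R
  -- The interval contains the spectrum of `P.1 k B` for every `k` and every tuple bounded by `R`,
  -- so one polynomial serves all of them.
  obtain ⟨g, hg⟩ := exists_polynomial_near_of_continuousOn (-C) C
    (fun t => max (-c) (min c t)) (by fun_prop) ε hε
  obtain ⟨Q, hQ, hQP⟩ := polyAlg_aeval_mem hP (g.map (algebraMap ℝ ℂ))
  refine ⟨Q, hQ, fun k B hB => ?_, fun k => ?_⟩
  · rw [hQP]
    exact norm_aeval_clamp_le (hherm k B) hc (hC k B hB) fun t ht => (hg t ht).le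
  · rw [hQP]
    exact tnorm_aeval_clamp_sub_le (hherm k _) (hX k) (hXc k) (hC k _ (hY k))
      fun t ht => (hg t ht).le

/-- A matrix form of Kaplansky density. A 2-norm approximant may be large in operator norm, so its
real and imaginary parts are truncated at height `c`; this does little harm because those of the
lift `X` are bounded by `c`. The resulting bound depends neither on `η` nor on `R`. -/
theorem exists_bounded_approximant {τ : A →ₗ[ℂ] ℂ} {θ : A →⋆ₐ[ℂ] MatUltra ω}
    (hθ : ∀ a, ultraTrace ω (θ a) = τ a) {p : ℕ} {y : Fin p → A} (hy : TraceDense τ y)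
    {Y : Fin p → BddSeq} (hY : ∀ j, mkUltra ω (Y j) = θ (y j)) {a : A} {X : BddSeq}
    (hX : mkUltra ω X = θ a) {R c η : ℝ} (hYR : ∀ k j, ‖Y j k‖ ≤ R) (hXc : ∀ k, ‖X k‖ ≤ c)
    (hη : 0 < η) :
    ∃ P ∈ polyAlg y, (∀ k (B : Fin p → Mat k), (∀ j, ‖B j‖ ≤ R) → ‖P.1 k B‖ ≤ 2 * (c + 1)) ∧
      ∀ᶠ k in (ω : Filter ℕ+), tnorm (P.1 k (fun j => Y j k) - X k) < η := by
  have hc : 0 ≤ c := (norm_nonneg _).trans (hXc 1)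
  obtain ⟨b, hb, hba⟩ := hy a ((η / 4) ^ 2) (by positivity)
  obtain ⟨P, hP, rfl⟩ := exists_mem_polyAlg_snd hb
  obtain ⟨Z, hZ, hZP⟩ := exists_lift_polyAlg θ hY hP
  have hclose : ∀ᶠ k in (ω : Filter ℕ+), tnorm ((Z - X) k) < η / 4 :=
    eventually_tnorm_lt_of_lift hθ (by rw [map_sub, hZP, hX, map_sub]) (by positivity) hba
  -- With `ε ≤ 1` the two parts have total norm at most `2 * (c + 1)`; with `ε ≤ η / 8` their total
  -- error is below `2 * (ε + η / 4) ≤ 3 * η / 4`.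
  set ε : ℝ := min 1 (η / 8) with hε_def
  have hε : 0 < ε := by positivity
  have hhalf : star (1 / 2 : ℂ) = 1 / 2 := by simp
  -- real and imaginary parts
  have key : ∀ u v : ℂ, star u = v → ‖u‖ = 1 / 2 → ∃ Q ∈ polyAlg y,
      (∀ k (B : Fin p → Mat k), (∀ j, ‖B j‖ ≤ R) → ‖Q.1 k B‖ ≤ c + ε) ∧
      ∀ᶠ k in (ω : Filter ℕ+),
        tnorm (Q.1 k (fun j => Y j k) - (u • X k + v • star (X k))) < ε + η / 4 := by
    intro u v huv hu
    have hv : ‖v‖ = 1 / 2 := by rw [← huv, norm_star, hu]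
    have hvu : star v = u := by rw [← huv, star_star]
    obtain ⟨Q, hQ, hQ1, hQ2⟩ := exists_bounded_approximant_of_hermitian (R := R) (c := c) (ε := ε)
      (Y := fun k j => Y j k) (X := fun k => u • X k + v • star (X k)) (P := u • P + v • star P)
      (add_mem ((polyAlg y).smul_mem hP u) ((polyAlg y).smul_mem (star_mem hP) v))
      (fun k B => by
        change star (u • P.1 k B + v • star (P.1 k B)) = u • P.1 k B + v • star (P.1 k B)
        rw [star_add, star_smul, star_smul, star_star, huv, hvu, add_comm]) hc hε hYR
      (fun k => by rw [star_add, star_smul, star_smul, star_star, huv, hvu, add_comm])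
      (fun k => by
        refine (norm_add_le _ _).trans ?_
        rw [norm_smul, norm_smul, norm_star, hu, hv]
        linarith [hXc k])
    refine ⟨Q, hQ, hQ1, ?_⟩
    filter_upwards [hclose] with k hk
    refine (hQ2 k).trans_lt (add_lt_add_of_le_of_lt le_rfl (lt_of_le_of_lt ?_ hk))
    have h1 : (u • P + v • star P).1 k (fun j => Y j k) - (u • X k + v • star (X k)) =
        u • (Z - X) k + v • star ((Z - X) k) := by
      change u • P.1 k _ + v • star (P.1 k _) - _ = u • (Z k - X k) + v • star (Z k - X k)
      rw [hZ, star_sub, smul_sub, smul_sub]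
      abel
    rw [h1]
    refine (tnorm_add_le _ _).trans ?_
    rw [tnorm_smul, tnorm_smul, tnorm_star, hu, hv]
    linarith
  obtain ⟨Q1, hQ1, hQ1n, hQ1c⟩ := key (1 / 2) (1 / 2) hhalf (by simp)
  obtain ⟨Q2, hQ2, hQ2n, hQ2c⟩ := key (-(Complex.I / 2)) (Complex.I / 2) (by simp [neg_div]) (by simp)
  have hε1 : ε ≤ 1 := min_le_left _ _
  have hε2 : ε ≤ η / 8 := min_le_right _ _
  refine ⟨Q1 + Complex.I • Q2, add_mem hQ1 ((polyAlg y).smul_mem hQ2 _), fun k B hB => ?_, ?_⟩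
  · change ‖Q1.1 k B + Complex.I • Q2.1 k B‖ ≤ _
    refine (norm_add_le _ _).trans ?_
    rw [norm_smul, Complex.norm_I]
    linarith [hQ1n k B hB, hQ2n k B hB]
  · filter_upwards [hQ1c, hQ2c] with k h1 h2
    change tnorm (Q1.1 k _ + Complex.I • Q2.1 k _ - X k) < η
    have h3 : Q1.1 k (fun j => Y j k) + Complex.I • Q2.1 k (fun j => Y j k) - X k =
        (Q1.1 k (fun j => Y j k) - ((1 / 2 : ℂ) • X k + (1 / 2 : ℂ) • star (X k))) +
        Complex.I • (Q2.1 k (fun j => Y j k) -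
          ((-(Complex.I / 2)) • X k + (Complex.I / 2) • star (X k))) := by
      rw [smul_sub, smul_add, smul_smul, smul_smul]
      have e1 : Complex.I * -(Complex.I / 2) = 1 / 2 := by
        linear_combination (-1 / 2 : ℂ) * Complex.I_mul_I
      have e2 : Complex.I * (Complex.I / 2) = -(1 / 2) := by
        linear_combination (1 / 2 : ℂ) * Complex.I_mul_I
      rw [e1, e2]
      module
    rw [h3]
    refine (tnorm_add_le _ _).trans_lt ?_
    rw [tnorm_smul, Complex.norm_I]
    linarith

end Approximants

/-! ### Transfer of microstates from one generating family to another. -/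

section Transfer

variable {A : Type*} [Ring A] [StarRing A] [Algebra ℂ A] {ω : Ultrafilter ℕ+}

theorem map_one_of_embedding {τ : A →ₗ[ℂ] ℂ} {θ : A →⋆ₐ[ℂ] MatUltra ω}
    (hθ : ∀ a, ultraTrace ω (θ a) = τ a) : τ 1 = 1 := by
  have h := tendsto_ntr_of_lift hθ (Z := 1) (z := 1) (by rw [map_one, map_one])
  refine tendsto_nhds_unique h ?_
  refine tendsto_const_nhds.congr fun k => ?_
  exact ntr_one.symm

/-- All trace-preserving embeddings give the same *-moments, so the union is over copies of a single
set and any one `θ` may be used. -/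
theorem mem_nbhd_iff {τ : A →ₗ[ℂ] ℂ} (hemb : (Embeddings ω τ).Nonempty) {n : ℕ} {R : ℝ}
    {ξ : ℕ+ → ℕ+} {x : Fin n → A} {Y : Fin n → (k : ℕ+) → Mat k} :
    Y ∈ nbhd ω τ R ξ x ↔ (∀ i k, ‖Y i k‖ < R) ∧
      ∀ m k : ℕ+, ξ m ≤ k → Approx τ x m (fun i => Y i k) := by
  simp only [nbhd, Set.mem_iUnion, exists_prop]
  have hθ : ∀ θ ∈ Embeddings ω τ, (Y ∈ nbhdUltra ω R ξ (fun i => θ (x i)) ↔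
      (∀ i k, ‖Y i k‖ < R) ∧ ∀ m k : ℕ+, ξ m ≤ k → Approx τ x m (fun i => Y i k)) := by
    intro θ hθ
    simp only [nbhdUltra, Approx, Set.mem_ofPred_eq, ← map_starWord θ x, hθ.2]
  obtain ⟨θ, h⟩ := hemb
  exact ⟨fun ⟨θ', h', hY⟩ => (hθ θ' h').1 hY, fun hY => ⟨θ, h, (hθ θ h).2 hY⟩⟩

theorem embDim_eq_of_map {A' : Type*} [Ring A'] [StarRing A'] [Algebra ℂ A'] {τ : A →ₗ[ℂ] ℂ}
    {σ : A' →ₗ[ℂ] ℂ} (hemb : (Embeddings ω τ).Nonempty) (hemb' : (Embeddings ω σ).Nonempty)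
    (Φ : A →⋆ₐ[ℂ] A') (hΦ : ∀ a, σ (Φ a) = τ a) {n : ℕ} (x : Fin n → A) (s : ℝ) :
    embDim ω τ s x = embDim ω σ s (fun i => Φ (x i)) := by
  have h : ∀ R ξ, nbhd ω τ R ξ x = nbhd ω σ R ξ (fun i => Φ (x i)) := by
    intro R ξ
    ext Y
    simp only [mem_nbhd_iff hemb, mem_nbhd_iff hemb', Approx, ← map_starWord Φ, hΦ]
  simp only [embDim, embDimAt, h]

theorem Embeddings.nonempty_of_equiv {A' : Type*} [Ring A'] [StarRing A'] [Algebra ℂ A']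
    {τ : A →ₗ[ℂ] ℂ} {σ : A' →ₗ[ℂ] ℂ} (hemb : (Embeddings ω τ).Nonempty) (Φ : A ≃⋆ₐ[ℂ] A')
    (hΦ : ∀ a, σ (Φ a) = τ a) : (Embeddings ω σ).Nonempty := by
  obtain ⟨θ, hinj, hθ⟩ := hemb
  refine ⟨θ.comp (Φ.symm : A' →⋆ₐ[ℂ] A), hinj.comp Φ.symm.injective, fun a => ?_⟩
  rw [StarAlgHom.comp_apply, hθ, ← hΦ]
  exact congrArg σ (Φ.apply_symm_apply a)

variable [StarModule ℂ A]

theorem tendsto_ntr_polyAlg {τ : A →ₗ[ℂ] ℂ} {θ : A →⋆ₐ[ℂ] MatUltra ω}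
    (hθ : ∀ a, ultraTrace ω (θ a) = τ a) {p : ℕ} {y : Fin p → A} {Y : Fin p → BddSeq}
    (hY : ∀ j, mkUltra ω (Y j) = θ (y j)) {P : MatFun p × A} (hP : P ∈ polyAlg y) :
    Tendsto (fun k => ntr (P.1 k (fun j => Y j k))) ω (𝓝 (τ P.2)) := by
  obtain ⟨Z, hZ, hZP⟩ := exists_lift_polyAlg θ hY hP
  exact (tendsto_ntr_of_lift hθ hZP).congr fun k => by rw [hZ]

/-- The witness is `D = P(B)` with `P(y)` close to `x`. Both the moments of `D` and the distance
from `Q(D)` to `B` are traces of *-polynomials in `B`, hence governed by finitely many moments of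
`y`; their limiting values are read off along the lifts `X`, `Y`. The norm bound on `D` does not
depend on `m`. -/
theorem exists_microstate_transfer {τ : A →ₗ[ℂ] ℂ} {θ : A →⋆ₐ[ℂ] MatUltra ω}
    (hθ : ∀ a, ultraTrace ω (θ a) = τ a) {n p : ℕ} {x : Fin n → A} {y : Fin p → A}
    (hy : TraceDense τ y) {X : Fin n → BddSeq} {Y : Fin p → BddSeq}
    (hX : ∀ i, mkUltra ω (X i) = θ (x i)) (hY : ∀ j, mkUltra ω (Y j) = θ (y j)) (R : ℝ) {c : ℝ}
    (hc : 0 ≤ c) (hXc : ∀ i k, ‖X i k‖ ≤ c) {Q : Fin p → MatFun n × A}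
    (hQ : ∀ j, Q j ∈ polyAlg x) {ε : ℝ} (hε : 0 < ε)
    (hQY : ∀ j, ∀ᶠ k in (ω : Filter ℕ+), tnorm ((Q j).1 k (fun i => X i k) - Y j k) < ε)
    (m : ℕ+) :
    ∃ M : ℕ+, ∀ k (B : Fin p → Mat k), (∀ j, ‖B j‖ ≤ R) → Approx τ y M B →
      ∃ D : Fin n → Mat k, (∀ i, ‖D i‖ ≤ 2 * (c + 1)) ∧ Approx τ x m D ∧
        ∀ j, tnorm ((Q j).1 k D - B j) < 2 * ε := by
  have hm : (0 : ℝ) < 1 / (2 * (m : ℕ)) := by have := m.pos; positivity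
  set words : Set (List (Fin n × Bool)) := {w | w.length ≤ (m : ℕ)} with hwords
  have hfin : words.Finite := List.finite_length_le _ _
  set wp : List (Fin n × Bool) → MatFun n × A := fun w => starWord (polyGen x) w with hwp
  have hwpm : ∀ w, wp w ∈ polyAlg x := fun w => starWord_mem (polyAlg x) (polyGen_mem x) w
  choose Lw hLw0 hLw using fun w => exists_lipschitz (hwpm w) (2 * (c + 1))
  choose Lq hLq0 hLq using fun j => exists_lipschitz (hQ j) (2 * (c + 1))
  have hsmall : ∀ L r : ℝ, 0 < r → ∀ᶠ η in 𝓝[>] (0 : ℝ), L * η < r := by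
    intro L r hr
    have h : Tendsto (fun η : ℝ => L * η) (𝓝[>] 0) (𝓝 (L * 0)) :=
      (tendsto_nhdsWithin_of_tendsto_nhds tendsto_id).const_mul L
    rw [mul_zero] at h
    exact h.eventually_lt_const hr
  obtain ⟨η, hηw, hηq, hη⟩ : ∃ η : ℝ, (∀ w ∈ words, Lw w * η < 1 / (2 * (m : ℕ))) ∧
      (∀ j, Lq j * η < ε / 4) ∧ 0 < η := by
    have h1 : ∀ᶠ η in 𝓝[>] (0 : ℝ), ∀ w ∈ words, Lw w * η < 1 / (2 * (m : ℕ)) :=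
      (eventually_all_finite hfin).2 fun w _ => hsmall _ _ hm
    have h2 : ∀ᶠ η in 𝓝[>] (0 : ℝ), ∀ j, Lq j * η < ε / 4 :=
      eventually_all.2 fun j => hsmall _ _ (by positivity)
    exact (h1.and (h2.and self_mem_nhdsWithin)).exists
  -- The bound on `P` must hold both at the given tuples `B` and at the lifts `Y`.
  set R₁ : ℝ := max R (∑ j, ‖Y j‖) with hR₁
  have hYR : ∀ k j, ‖Y j k‖ ≤ R₁ := fun k j =>
    (lp.norm_apply_le_norm ENNReal.top_ne_zero (Y j) k).trans
      ((Finset.single_le_sum (f := fun j => ‖Y j‖) (fun _ _ => norm_nonneg _)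
        (Finset.mem_univ j)).trans (le_max_right _ _))
  have hex := fun i => exists_bounded_approximant hθ hy hY (hX i) hYR (hXc i)
    (η := η / (n + 1)) (by positivity)
  choose P hP hPn hPc using hex
  have hclose : ∀ᶠ k in (ω : Filter ℕ+),
      norm2 ((fun i => (P i).1 k (fun j => Y j k)) - fun i => X i k) ≤ η := by
    filter_upwards [eventually_all.2 hPc] with k hk
    refine (norm2_le_sum_tnorm _).trans ?_
    refine (Finset.sum_le_sum (g := fun _ => η / (n + 1)) fun i _ => (hk i).le).trans ?_
    rw [Finset.sum_const, Finset.card_univ, Fintype.card_fin, nsmul_eq_mul, ← mul_div_assoc,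
      div_le_iff₀ (by positivity)]
    nlinarith
  have hlip : ∀ (V : MatFun n × A) (L : ℝ), 0 ≤ L → (∀ k (B B' : Fin n → Mat k),
      (∀ j, ‖B j‖ ≤ 2 * (c + 1)) → (∀ j, ‖B' j‖ ≤ 2 * (c + 1)) →
      tnorm (V.1 k B - V.1 k B') ≤ L * norm2 (B - B')) → ∀ᶠ k in (ω : Filter ℕ+),
      tnorm (V.1 k (fun i => (P i).1 k (fun j => Y j k)) - V.1 k (fun i => X i k)) ≤ L * η := by
    intro V L hL hV
    filter_upwards [hclose] with k hk
    exact (hV k _ _ (fun i => hPn i k _ (hYR k)) (fun i => (hXc i k).trans (by linarith))).trans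
      (mul_le_mul_of_nonneg_left hk hL)
  choose Vw hVw hVwP using fun w => exists_comp_mem_polyAlg hP (hwpm w)
  choose Vq hVq hVqP using fun j => exists_comp_mem_polyAlg hP (hQ j)
  have hτ1 := map_one_of_embedding hθ
  -- Both traces are limits along `ω`, at `P(Y)` and at `X`, and these tuples are within `η` of each
  -- other. The other half of the error `1 / m` is spent in `hev1`.
  have hmoment : ∀ w ∈ words, ‖τ (Vw w).2 - τ (starWord x w)‖ < 1 / (2 * (m : ℕ)) := by
    intro w hw
    have h1 := tendsto_ntr_polyAlg hθ hY (hVw w)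
    have h2 := tendsto_ntr_polyAlg hθ hX (hwpm w)
    have h3 : (wp w).2 = starWord x w := polyAlg_snd_starWord x w
    rw [h3] at h2
    refine lt_of_le_of_lt (le_of_tendsto (h1.sub h2).norm ?_) (hηw w hw)
    filter_upwards [hlip _ _ (hLw0 w) (hLw w)] with k hk
    rw [← ntr_sub, hVwP]
    exact (norm_ntr_le_tnorm _).trans hk
  have hev1 : ∀ᶠ M : ℕ+ in atTop, ∀ w ∈ words, ∀ k (B : Fin p → Mat k), Approx τ y M B →
      ‖ntr ((Vw w).1 k B) - τ (Vw w).2‖ < 1 / (2 * (m : ℕ)) :=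
    (eventually_all_finite hfin).2 fun w _ => eventually_ntr_close hτ1 (hVw w) hm
  set G : Fin p → MatFun p × A := fun j => Vq j - polyGen y j with hG
  have hGm : ∀ j, star (G j) * G j ∈ polyAlg y := fun j =>
    mul_mem (star_mem (sub_mem (hVq j) (polyGen_mem y j))) (sub_mem (hVq j) (polyGen_mem y j))
  have hGapply : ∀ j k (B : Fin p → Mat k), (star (G j) * G j).1 k B =
      star ((Q j).1 k (fun i => (P i).1 k B) - B j) * ((Q j).1 k (fun i => (P i).1 k B) - B j) := by
    intro j k B
    rw [← hVqP j k B]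
    rfl
  -- An error `ε / 4` comes from replacing `P(Y)` by `X`, and `ε` from `Q(X)` against `Y`. With the
  -- error `ε ^ 2` of `hev2` the sum is `(25 / 16 + 1) * ε ^ 2 < (2 * ε) ^ 2`.
  have hGτ : ∀ j, (τ (star (G j) * G j).2).re ≤ (5 / 4 * ε) ^ 2 := by
    intro j
    have h1 := (Complex.continuous_re.tendsto _).comp (tendsto_ntr_polyAlg hθ hY (hGm j))
    refine le_of_tendsto h1 ?_
    filter_upwards [hlip _ _ (hLq0 j) (hLq j), hQY j] with k hk hk'
    rw [Function.comp_apply, hGapply, ntr_star_mul_self, Complex.ofReal_re, ← tnorm_sq]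
    refine pow_le_pow_left₀ (tnorm_nonneg _) ?_ 2
    refine (tnorm_sub_le _ ((Q j).1 k fun i => X i k) _).trans ?_
    linarith [hηq j]
  have hev2 : ∀ᶠ M : ℕ+ in atTop, ∀ j, ∀ k (B : Fin p → Mat k), Approx τ y M B →
      ‖ntr ((star (G j) * G j).1 k B) - τ (star (G j) * G j).2‖ < ε ^ 2 :=
    eventually_all.2 fun j => eventually_ntr_close hτ1 (hGm j) (by positivity)
  obtain ⟨M, hM1, hM2⟩ := (hev1.and hev2).exists
  refine ⟨M, fun k B hB hBM => ⟨fun i => (P i).1 k B, fun i => ?_, fun w _ hw => ?_, fun j => ?_⟩⟩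
  · exact hPn i k B fun j => (hB j).trans (le_max_left _ _)
  · have h1 := hM1 w hw k B hBM
    rw [hVwP] at h1
    have h2 : (wp w).1 k (fun i => (P i).1 k B) = starWord (fun i => (P i).1 k B) w :=
      polyAlg_fst_starWord x w _
    rw [h2] at h1
    have h3 := hmoment w hw
    have h4 : (1 : ℝ) / (m : ℕ) = 1 / (2 * (m : ℕ)) + 1 / (2 * (m : ℕ)) := by
      have : ((m : ℕ) : ℝ) ≠ 0 := by exact_mod_cast m.ne_zero
      field_simp
      norm_num
    rw [h4, ← sub_add_sub_cancel _ (τ (Vw w).2)]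
    exact (norm_add_le _ _).trans_lt (add_lt_add h1 h3)
  · have h1 := (Complex.abs_re_le_norm _).trans_lt (hM2 j k B hBM)
    rw [hGapply, ntr_star_mul_self, Complex.sub_re, Complex.ofReal_re, ← tnorm_sq] at h1
    have h2 := (abs_lt.1 h1).2
    have h3 := hGτ j
    refine lt_of_pow_lt_pow_left₀ 2 (by positivity) ?_
    nlinarith [sq_pos_of_pos hε]

/-- The order of choices is what makes this work: `Q` depends on `δ` and `R'` only on the lifts `X`,
so the Lipschitz constant `Λ` is fixed before `δ'`, while the orders `M m` affect only `ξ'`. -/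
theorem embDim_le_of_traceDense {τ : A →ₗ[ℂ] ℂ} (hemb : (Embeddings ω τ).Nonempty)
    (hω : (ω : Filter ℕ+) ≤ Filter.cofinite) {n p : ℕ} {x : Fin n → A} {y : Fin p → A}
    (hx : TraceDense τ x) (hy : TraceDense τ y) (s : ℝ) :
    embDim ω τ s y ≤ embDim ω τ s x := by
  refine embDim_le_of_forall ω τ τ s fun δ hδ R hR ξ hξ => ?_
  obtain ⟨θ, hθΘ⟩ := id hemb
  have hθ := hθΘ.2
  choose X hX using fun i => mkUltra_surjective ω (θ (x i))
  choose Y hY using fun j => mkUltra_surjective ω (θ (y j))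
  set c : ℝ := ∑ i, ‖X i‖ with hc_def
  have hc : 0 ≤ c := Finset.sum_nonneg fun _ _ => norm_nonneg _
  have hXc : ∀ i k, ‖X i k‖ ≤ c := fun i k =>
    (lp.norm_apply_le_norm ENNReal.top_ne_zero (X i) k).trans
      (Finset.single_le_sum (f := fun i => ‖X i‖) (fun _ _ => norm_nonneg _) (Finset.mem_univ i))
  -- The `p` coordinate errors `2 * ε` then add up to less than `δ / 4`; `p + 1` also covers `p =
  -- 0`.
  set ε : ℝ := δ / (8 * (p + 1)) with hε_def
  have hδ' : 0 < δ := hδ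
  have hε : 0 < ε := by positivity
  have hQex : ∀ j, ∃ Q ∈ polyAlg x,
      ∀ᶠ k in (ω : Filter ℕ+), tnorm (Q.1 k (fun i => X i k) - Y j k) < ε := by
    intro j
    obtain ⟨b, hb, hba⟩ := hx (y j) (ε ^ 2) (by positivity)
    obtain ⟨Q, hQ, rfl⟩ := exists_mem_polyAlg_snd hb
    obtain ⟨Z, hZ, hZQ⟩ := exists_lift_polyAlg θ hX hQ
    refine ⟨Q, hQ, ?_⟩
    filter_upwards [eventually_tnorm_lt_of_lift hθ (Z := Z - Y j) (z := Q.2 - y j)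
      (by rw [map_sub, hZQ, hY, map_sub]) hε hba] with k hk
    rw [← hZ]
    exact hk
  choose Q hQ hQY using hQex
  choose M hM using exists_microstate_transfer hθ hy hX hY R hc hXc hQ hε hQY
  set R' : ℝ := 2 * (c + 1) + 1 with hR'
  choose L hL0 hL using fun j => exists_lipschitz (hQ j) R'
  -- For `k ≥ ξ' m` the moments of `y` are controlled to order `M m`, as the transfer to order `m`
  -- requires. The term `m` forces `ξ'` to infinity and leaves finitely many `m` for each `k`.
  set ξ' : ℕ+ → ℕ+ := fun m => max m (ξ (M m)) with hξ'_def
  have hξ' : ξ' ∈ Xi := tendsto_atTop_mono (fun m => le_max_left _ _) tendsto_id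
  set Λ : ℝ := ∑ j, L j with hΛ
  have hΛ0 : 0 ≤ Λ := Finset.sum_nonneg fun j _ => hL0 j
  have hδev : ∀ᶠ δ' in 𝓝[>] (0 : ℝ), Λ * δ' < δ / 4 := by
    have h : Tendsto (fun η : ℝ => Λ * η) (𝓝[>] 0) (𝓝 (Λ * 0)) :=
      (tendsto_nhdsWithin_of_tendsto_nhds tendsto_id).const_mul Λ
    rw [mul_zero] at h
    exact h.eventually_lt_const (by positivity)
  filter_upwards [hδev] with δ' hδ'
  refine ⟨R', by positivity, ξ', hξ', embDimAt_le_of_eventually ω τ τ s ?_⟩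
  have hlocal : ∀ k (B : Fin p → Mat k), (∀ j, ‖B j‖ < R) →
      (∀ m, ξ m ≤ k → Approx τ y m B) → ∃ D : Fin n → Mat k, (∀ i, ‖D i‖ < R') ∧
        (∀ m, ξ' m ≤ k → Approx τ x m D) ∧ (ξ' 1 ≤ k → ∀ j, tnorm ((Q j).1 k D - B j) < 2 * ε) := by
    intro k B hB hBm
    have hfin : {m : ℕ+ | ξ' m ≤ k}.Finite :=
      (Set.finite_Iic k).subset fun m hm => (le_max_left m _).trans hm
    rcases Set.eq_empty_or_nonempty {m : ℕ+ | ξ' m ≤ k} with hempty | hne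
    · have hnot : ∀ m, ¬ ξ' m ≤ k := fun m hm => by
        have : m ∈ {m : ℕ+ | ξ' m ≤ k} := hm
        rw [hempty] at this
        exact this
      -- At such small `k` no moment is prescribed, and the zero tuple fills the coordinate.
      refine ⟨0, fun i => ?_, fun m hm => absurd hm (hnot m), fun h1 => absurd h1 (hnot 1)⟩
      rw [Pi.zero_apply, norm_zero]
      positivity
    -- One `D` must serve every order prescribed at `k`; the largest order implies the others.
    · obtain ⟨m, hm, hmax⟩ := hfin.exists_maximal hne
      obtain ⟨D, hD, hDm, hDQ⟩ := hM m k B (fun j => (hB j).le)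
        (hBm _ ((le_max_right _ _).trans hm))
      refine ⟨D, fun i => (hD i).trans_lt (lt_add_one _), fun m' hm' => hDm.mono ?_, fun _ => hDQ⟩
      rcases le_total m' m with h | h
      · exact h
      · exact hmax hm' h
  have hcof : ∀ᶠ k : ℕ+ in (ω : Filter ℕ+), ξ' 1 ≤ k := by
    refine hω ?_
    rw [Filter.mem_cofinite]
    refine (Set.finite_Iio (ξ' 1)).subset fun k (hk : ¬ ξ' 1 ≤ k) => not_le.1 hk
  filter_upwards [hcof] with k hk
  refine orbitCov_le_of_approx_inverse (ε := δ / 4) (L := Λ) (fun D j => (Q j).1 k D) ?_ ?_ hΛ0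
    (by linarith)
  · rintro _ ⟨T, hT, rfl⟩
    rw [mem_nbhd_iff hemb] at hT
    -- `nbhd` consists of whole sequences, so the transfer is made at every coordinate, not only at
    -- the given `k`.
    choose D hD hDm hDQ using fun k => hlocal k (fun j => T j k) (fun j => hT.1 j k)
      (fun m hm => hT.2 m k hm)
    refine ⟨D k, ⟨fun i k => D k i, ?_, rfl⟩, ?_⟩
    · rw [mem_nbhd_iff hemb]
      exact ⟨fun i k => hD k i, fun m k hm => hDm k m hm⟩
    · refine (norm2_le_sum_tnorm _).trans_lt ?_
      refine (Finset.sum_le_sum (g := fun _ => 2 * ε) fun j _ => (hDQ k hk j).le).trans_lt ?_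
      rw [Finset.sum_const, Finset.card_univ, Fintype.card_fin, nsmul_eq_mul, hε_def]
      have : (p : ℝ) * (2 * (δ / (8 * (p + 1)))) = δ / 4 * (p / (p + 1)) := by
        field_simp
        ring
      rw [this]
      have hp : (p : ℝ) / (p + 1) < 1 := by
        rw [div_lt_one (by positivity)]
        exact lt_add_one _
      nlinarith
  · rintro _ ⟨T, hT, rfl⟩ _ ⟨T', hT', rfl⟩ W hW
    rw [mem_nbhd_iff hemb] at hT hT'
    refine (norm2_le_sum_tnorm _).trans ?_
    rw [hΛ, Finset.sum_mul]
    refine Finset.sum_le_sum fun j _ => ?_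
    have h1 := hL j k (projAt k T) (fun i => W * projAt k T' i * star W) (fun i => (hT.1 i k).le)
      (fun i => (norm_conj_le hW _).trans (hT'.1 i k).le)
    rw [polyAlg_conj (hQ j) hW] at h1
    exact h1

theorem TraceDense.map {A' : Type*} [Ring A'] [StarRing A'] [Algebra ℂ A'] [StarModule ℂ A']
    {τ : A →ₗ[ℂ] ℂ} {σ : A' →ₗ[ℂ] ℂ} (Φ : A ≃⋆ₐ[ℂ] A') (hΦ : ∀ a, σ (Φ a) = τ a) {n : ℕ}
    {x : Fin n → A} (hx : TraceDense τ x) : TraceDense σ (fun i => Φ (x i)) := by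
  intro a η hη
  obtain ⟨b, hb, hba⟩ := hx (Φ.symm a) η hη
  refine ⟨Φ b, ?_, ?_⟩
  · have h : Φ b ∈ (StarAlgebra.adjoin ℂ (Set.range x)).map (Φ : A →⋆ₐ[ℂ] A') := ⟨b, hb, rfl⟩
    rw [StarAlgHom.map_adjoin, ← Set.range_comp] at h
    exact h
  · rw [← hΦ, map_mul, map_star, map_sub, StarAlgEquiv.apply_symm_apply] at hba
    exact hba

end Transfer

/-! ### The double commutant theorem and 2-norm density. -/

section DoubleCommutant

variable {H : Type*} [NormedAddCommGroup H] [InnerProductSpace ℂ H] {ι : Type*}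

/-- The diagonal action of an operator on `ℓ²(ι, H)`. -/
noncomputable def ampl (ι : Type*) (T : H →L[ℂ] H) :
    lp (fun _ : ι => H) 2 →L[ℂ] lp (fun _ : ι => H) 2 :=
  LinearMap.mkContinuous
    { toFun := fun ζ => ⟨fun i => T (ζ i), by
        refine memℓp_gen ?_
        have h := (memℓp_gen_iff (p := 2) (by norm_num)).1 (lp.memℓp ζ)
        refine Summable.of_nonneg_of_le (fun i => by positivity) (fun i => ?_)
          (h.mul_left (‖T‖ ^ (2 : ℝ≥0∞).toReal))
        rw [← Real.mul_rpow (norm_nonneg _) (norm_nonneg _)]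
        exact Real.rpow_le_rpow (norm_nonneg _) (T.le_opNorm _) (by norm_num)⟩
      map_add' := fun ζ ζ' => by ext i; exact map_add T _ _
      map_smul' := fun c ζ => by ext i; simp } ‖T‖ (fun ζ => by
        refine lp.norm_le_of_forall_sum_le (by norm_num) (by positivity) fun s => ?_
        rw [Real.mul_rpow (norm_nonneg _) (norm_nonneg _)]
        refine le_trans ?_ (mul_le_mul_of_nonneg_left
          (lp.sum_rpow_le_norm_rpow (by norm_num) ζ s) (by positivity))
        rw [Finset.mul_sum]
        refine Finset.sum_le_sum fun i _ => ?_
        rw [← Real.mul_rpow (norm_nonneg _) (norm_nonneg _)]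
        exact Real.rpow_le_rpow (norm_nonneg _) (T.le_opNorm _) (by norm_num))

@[simp] theorem ampl_apply (T : H →L[ℂ] H) (ζ : lp (fun _ : ι => H) 2) (i : ι) :
    ampl ι T ζ i = T (ζ i) := rfl

theorem ampl_single [DecidableEq ι] (T : H →L[ℂ] H) (i : ι) (h : H) :
    ampl ι T (lp.single 2 i h) = lp.single 2 i (T h) := by
  ext j
  rcases eq_or_ne j i with rfl | hij
  · simp
  · simp [lp.single_apply, hij]

variable [CompleteSpace H]

/-- The vector form of the double commutant theorem, in an amplification. -/
theorem exists_norm_ampl_sub_lt (S : StarSubalgebra ℂ (H →L[ℂ] H)) {a : H →L[ℂ] H}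
    (ha : a ∈ Set.centralizer (Set.centralizer (S : Set (H →L[ℂ] H))))
    (ζ : lp (fun _ : ι => H) 2) {ε : ℝ} (hε : 0 < ε) :
    ∃ b ∈ S, ‖ampl ι b ζ - ampl ι a ζ‖ < ε := by
  classical
  let V : Submodule ℂ (lp (fun _ : ι => H) 2) :=
    { carrier := {v | ∃ b ∈ S, ampl ι b ζ = v}
      add_mem' := by
        rintro _ _ ⟨b, hb, rfl⟩ ⟨b', hb', rfl⟩
        exact ⟨b + b', add_mem hb hb', by ext i; simp⟩
      zero_mem' := ⟨0, zero_mem S, by ext i; simp⟩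
      smul_mem' := by
        rintro r _ ⟨b, hb, rfl⟩
        exact ⟨r • b, S.smul_mem hb r, by ext i; simp⟩ }
  let K : Submodule ℂ (lp (fun _ : ι => H) 2) := V.topologicalClosure
  have hKclosed : IsClosed (K : Set (lp (fun _ : ι => H) 2)) := V.isClosed_topologicalClosure
  have : CompleteSpace K := hKclosed.completeSpace_coe
  let P : lp (fun _ : ι => H) 2 →L[ℂ] lp (fun _ : ι => H) 2 := K.starProjection
  have hinv : ∀ b ∈ S, ∀ v ∈ K, ampl ι b v ∈ K := by
    intro b hb v hv
    have hmaps : Set.MapsTo (ampl ι b) (V : Set (lp (fun _ : ι => H) 2)) V := by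
      rintro _ ⟨b', hb', rfl⟩
      exact ⟨b * b', mul_mem hb hb', by ext i; simp⟩
    exact map_mem_closure (ampl ι b).continuous hv hmaps
  have hadj : ∀ (b : H →L[ℂ] H) (u v : lp (fun _ : ι => H) 2),
      inner ℂ (ampl ι b u) v = inner ℂ u (ampl ι (star b) v) := by
    intro b u v
    rw [lp.inner_eq_tsum, lp.inner_eq_tsum]
    refine tsum_congr fun i => ?_
    rw [ampl_apply, ampl_apply, ContinuousLinearMap.star_eq_adjoint,
      ContinuousLinearMap.adjoint_inner_right]
  have hcomm : ∀ b ∈ S, ∀ v, P (ampl ι b v) = ampl ι b (P v) := by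
    intro b hb v
    refine Submodule.eq_starProjection_of_mem_of_inner_eq_zero (hinv b hb _ ?_) ?_
    · exact Submodule.starProjection_apply_mem K v
    · intro w hw
      rw [← map_sub, hadj]
      exact Submodule.starProjection_inner_eq_zero v _ (hinv _ (star_mem hb) w hw)
  -- Since `S` is unital, `ζ` itself lies in the closure `K` of its orbit under `S`. It then
  -- suffices that the amplification of `a` commutes with the projection onto `K`.
  have hζ : ζ ∈ K := V.le_topologicalClosure ⟨1, one_mem S, by ext i; simp⟩
  -- the matrix entries of the projection lie in the commutant
  let E : ι → ι → H →L[ℂ] H := fun i j =>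
    (lp.evalCLM ℂ (fun _ : ι => H) 2 i) ∘L P ∘L
      (lp.singleContinuousLinearMap ℂ (fun _ : ι => H) 2 j)
  have hE : ∀ i j h, E i j h = P (lp.single 2 j h) i := fun i j h => rfl
  have hEcomm : ∀ i j, E i j ∈ Set.centralizer (S : Set (H →L[ℂ] H)) := by
    intro i j b hb
    ext h
    change b (E i j h) = E i j (b h)
    rw [hE, hE, ← ampl_single, hcomm b hb, ampl_apply]
  have haP : P ∘L ampl ι a = ampl ι a ∘L P := by
    refine lp.ext_continuousLinearMap (by norm_num) fun j => ?_
    ext h i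
    change P (ampl ι a (lp.single 2 j h)) i = a (P (lp.single 2 j h) i)
    rw [ampl_single]
    exact congrArg (fun T : H →L[ℂ] H => T h) (ha (E i j) (hEcomm i j))
  have hmem : ampl ι a ζ ∈ K := by
    have h1 : P (ampl ι a ζ) = ampl ι a (P ζ) := congrArg (fun T => T ζ) haP
    rw [Submodule.starProjection_eq_self_iff.2 hζ] at h1
    rw [← h1]
    exact Submodule.starProjection_apply_mem K _
  obtain ⟨v, ⟨b, hb, rfl⟩, hv⟩ := Metric.mem_closure_iff.1 hmem ε hε
  refine ⟨b, hb, ?_⟩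
  rwa [dist_comm, dist_eq_norm] at hv

/-- The double commutant of a *-algebra of operators. -/
noncomputable def doubleCommutant (S : StarSubalgebra ℂ (H →L[ℂ] H)) : VonNeumannAlgebra H where
  toStarSubalgebra := StarSubalgebra.centralizer ℂ
    (StarSubalgebra.centralizer ℂ (S : Set (H →L[ℂ] H)) : Set (H →L[ℂ] H))
  centralizer_centralizer' := by
    change Set.centralizer (Set.centralizer (StarSubalgebra.centralizer ℂ
      (StarSubalgebra.centralizer ℂ (S : Set (H →L[ℂ] H)) : Set (H →L[ℂ] H)) : Set (H →L[ℂ] H)))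
      = (StarSubalgebra.centralizer ℂ
      (StarSubalgebra.centralizer ℂ (S : Set (H →L[ℂ] H)) : Set (H →L[ℂ] H)) : Set (H →L[ℂ] H))
    rw [StarSubalgebra.coe_centralizer, Set.centralizer_centralizer_centralizer]

/-- `StarSubalgebra.centralizer` adjoins the adjoints to a set before taking its commutant, which
changes nothing for a *-closed set. -/
theorem coe_doubleCommutant (S : StarSubalgebra ℂ (H →L[ℂ] H)) :
    (doubleCommutant S : Set (H →L[ℂ] H)) =
      Set.centralizer (Set.centralizer (S : Set (H →L[ℂ] H))) := by
  have hstar : ∀ T : StarSubalgebra ℂ (H →L[ℂ] H),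
      (T : Set (H →L[ℂ] H)) ∪ star (T : Set (H →L[ℂ] H)) = T := fun T =>
    Set.union_eq_self_of_subset_right fun b hb => by simpa using star_mem (s := T) hb
  change ((StarSubalgebra.centralizer ℂ (StarSubalgebra.centralizer ℂ (S : Set (H →L[ℂ] H)) :
    Set (H →L[ℂ] H)) : StarSubalgebra ℂ (H →L[ℂ] H)) : Set (H →L[ℂ] H)) = _
  rw [StarSubalgebra.coe_centralizer, hstar, StarSubalgebra.coe_centralizer, hstar]

end DoubleCommutant

/-- Generators of a von Neumann algebra generate a *-algebra that is dense in the 2-norm of a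
normal tracial state. -/
theorem traceDense_of_generates {H : Type*} [NormedAddCommGroup H] [InnerProductSpace ℂ H]
    [CompleteSpace H] {N : VonNeumannAlgebra H} {τ : N.toStarSubalgebra →ₗ[ℂ] ℂ}
    (hτ : IsNormalTracialState N τ) {n : ℕ} {x : Fin n → N.toStarSubalgebra}
    (hx : Generates N x) : TraceDense τ x := by
  intro a η hη
  obtain ⟨ξ, θ, hξ, hθ, hnormal⟩ := hτ.normal
  have hmem : Memℓp (Sum.elim ξ θ) 2 := by
    refine memℓp_gen ?_
    have h2 : (2 : ℝ≥0∞).toReal = ((2 : ℕ) : ℝ) := by norm_num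
    rw [h2]
    simp only [Real.rpow_natCast]
    exact Summable.sum (fun i => ‖Sum.elim ξ θ i‖ ^ 2) hξ hθ
  -- Both families representing the normal trace are stacked into one vector, so that a single `b`
  -- is close to `a` on all of them at once.
  let ζ : lp (fun _ : ℕ ⊕ ℕ => H) 2 := ⟨Sum.elim ξ θ, hmem⟩
  have hN : (a : H →L[ℂ] H) ∈ doubleCommutant
      ((StarAlgebra.adjoin ℂ (Set.range x)).map N.toStarSubalgebra.subtype) := by
    refine hx _ (fun i => ?_) a.2
    rw [← SetLike.mem_coe, coe_doubleCommutant]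
    exact Set.subset_centralizer_centralizer ⟨x i, StarAlgebra.subset_adjoin ℂ _ ⟨i, rfl⟩, rfl⟩
  rw [← SetLike.mem_coe, coe_doubleCommutant] at hN
  obtain ⟨_, ⟨b, hb, rfl⟩, hbζ⟩ := exists_norm_ampl_sub_lt _ hN ζ (Real.sqrt_pos.2 hη)
  refine ⟨b, hb, ?_⟩
  set d : N.toStarSubalgebra := b - a with hd
  set v : lp (fun _ : ℕ ⊕ ℕ => H) 2 :=
    ampl (ℕ ⊕ ℕ) (N.toStarSubalgebra.subtype b) ζ - ampl (ℕ ⊕ ℕ) (a : H →L[ℂ] H) ζ with hv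
  have hvl : ∀ i, v (Sum.inl i) = (d : H →L[ℂ] H) (ξ i) := fun i => rfl
  have hvr : ∀ i, v (Sum.inr i) = (d : H →L[ℂ] H) (θ i) := fun i => rfl
  have hsq : HasSum (fun i => ‖v i‖ ^ 2) (‖v‖ ^ 2) := by
    have := lp.hasSum_norm (p := 2) (by norm_num) v
    simpa using this
  have hsum := hsq.summable
  have h1 : Summable fun i => ‖v (Sum.inl i)‖ ^ 2 := hsum.comp_injective Sum.inl_injective
  have h2 : Summable fun i => ‖v (Sum.inr i)‖ ^ 2 := hsum.comp_injective Sum.inr_injective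
  have htsum : ∑' i, ‖v i‖ ^ 2 = ∑' i, (‖v (Sum.inl i)‖ ^ 2 + ‖v (Sum.inr i)‖ ^ 2) := by
    rw [h1.tsum_add h2]
    exact Summable.tsum_sum (f := fun i => ‖v i‖ ^ 2) h1 h2
  have hτd := Complex.hasSum_re (hnormal (star d * d))
  -- `τ (star d * d)` is the sum of the inner products of `d (θ i)` and `d (ξ i)`; Cauchy-Schwarz
  -- and the arithmetic-geometric mean inequality bound it by the squared norm of `v`.
  have hle : (τ (star d * d)).re ≤ ‖v‖ ^ 2 := by
    rw [← hsq.tsum_eq, htsum]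
    refine hasSum_le (fun i => ?_) hτd (h1.add h2).hasSum
    have h3 : inner ℂ (θ i) (((star d * d : N.toStarSubalgebra) : H →L[ℂ] H) (ξ i)) =
        inner ℂ (v (Sum.inr i)) (v (Sum.inl i)) := by
      rw [hvl, hvr]
      change inner ℂ (θ i) ((star (d : H →L[ℂ] H)) ((d : H →L[ℂ] H) (ξ i))) = _
      rw [ContinuousLinearMap.star_eq_adjoint, ContinuousLinearMap.adjoint_inner_right]
    rw [h3]
    refine (Complex.re_le_norm _).trans ((norm_inner_le_norm _ _).trans ?_)
    nlinarith [sq_nonneg (‖v (Sum.inl i)‖ - ‖v (Sum.inr i)‖)]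
  refine hle.trans_lt ?_
  rw [← Real.sq_sqrt hη.le]
  exact pow_lt_pow_left₀ hbζ (norm_nonneg _) two_ne_zero

end EmbDim

theorem theorem1 {H : Type*} [NormedAddCommGroup H] [InnerProductSpace ℂ H] [CompleteSpace H]
    (N : VonNeumannAlgebra H) (τ : N.toStarSubalgebra →ₗ[ℂ] ℂ)
    (hτ : EmbDim.IsNormalTracialState N τ)
    (ω : Ultrafilter ℕ+) (hω : (ω : Filter ℕ+) ≤ Filter.cofinite)
    (hemb : (EmbDim.Embeddings ω τ).Nonempty)
    {n : ℕ} (x : Fin n → N.toStarSubalgebra) (hx : EmbDim.Generates N x) :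
    (∀ (p : ℕ) (y : Fin p → N.toStarSubalgebra), EmbDim.Generates N y →
      ∀ s : ℝ, 0 ≤ s → EmbDim.embDim ω τ s x = EmbDim.embDim ω τ s y) ∧
    (∀ (K : Type*) [NormedAddCommGroup K] [InnerProductSpace ℂ K] [CompleteSpace K]
      (M : VonNeumannAlgebra K) (σ : M.toStarSubalgebra →ₗ[ℂ] ℂ),
      EmbDim.IsNormalTracialState M σ →
      ∀ Φ : N.toStarSubalgebra ≃⋆ₐ[ℂ] M.toStarSubalgebra, (∀ a, σ (Φ a) = τ a) →
      ∀ (p : ℕ) (y : Fin p → M.toStarSubalgebra), EmbDim.Generates M y →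
      ∀ s : ℝ, 0 ≤ s → EmbDim.embDim ω τ s x = EmbDim.embDim ω σ s y) := by
  have hxd := EmbDim.traceDense_of_generates hτ hx
  refine ⟨fun p y hy s _ => ?_, fun K _ _ _ M σ hσ Φ hΦ p y hy s _ => ?_⟩
  · have hyd := EmbDim.traceDense_of_generates hτ hy
    exact le_antisymm (EmbDim.embDim_le_of_traceDense hemb hω hyd hxd s)
      (EmbDim.embDim_le_of_traceDense hemb hω hxd hyd s)
  · have hemb' := EmbDim.Embeddings.nonempty_of_equiv hemb Φ hΦ
    have hyd := EmbDim.traceDense_of_generates hσ hy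
    have hxd' := hxd.map Φ hΦ
    -- The family `x` is moved into `M`, where it is compared with `y`. Density of its image comes
    -- from `TraceDense.map`, so `Φ` need not be spatially implemented.
    rw [EmbDim.embDim_eq_of_map hemb hemb' (Φ : N.toStarSubalgebra →⋆ₐ[ℂ] M.toStarSubalgebra) hΦ]
    exact le_antisymm (EmbDim.embDim_le_of_traceDense hemb' hω hyd hxd' s)
      (EmbDim.embDim_le_of_traceDense hemb' hω hxd' hyd s)
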